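/- Let $F$ be a countable (possibly finite) field, let $W$ be a finite-dimensional vector space over $F$, and let $T=(T^w)_{w\in W}$ be an action of the additive group $(W,+)$ on a probability space $(X,\mathscr{B},\mu)$ by measurable, $\mu$-preserving maps. Let $n \ge 0$. A monomial is a map $F^n\to F$ of the form $(x_1,\dots,x_n)\mapsto a x_1^{d_1}\cdots x_n^{d_n}$ with $a\in F$ and integers $d_i\ge 0$ that are not all zero, and a map $\varphi:F^n\to W$ is called a polynomial if it has the form $\varphi(x)=\sum_{j=1}^k m_j(x)\,w_j$ with monomials $m_j$ and vectors $w_j\in W$ (so that $\varphi$ has no constant term). For an abelian group $G$ and an integer $r\ge 1$, a subset of $G$ is an $\mathrm{IP}_r$ set if it contains $\{\sum_{i\in\alpha}x_i : \emptyset\ne\alpha\subset\{1,\dots,r\}\}$ for some $x_1,\dots,x_r\in G$, and it is $\mathrm{IP}^*_r$ if it meets every $\mathrm{IP}_r$ set in $G$. A Følner sequence in $G$ is a sequence $(\Phi_N)$ of finite non-empty subsets of $G$ with $|(g+\Phi_N)\cap\Phi_N|/|\Phi_N|\to 1$ for every $g\in G$. The upper Banach density of $S\subset G$ is the supremum, over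 all Følner sequences $(\Phi_N)$ in $G$, of $\limsup_{N\to\infty}|S\cap\Phi_N|/|\Phi_N|$. A subset of $G$ is almost $\mathrm{IP}^*_r$ if it is of the form $A\setminus E$ where $A$ is $\mathrm{IP}^*_r$ and $E$ has upper Banach density zero. Then for every polynomial $\varphi:F^n\to W$, every $B\in\mathscr{B}$ and every $\varepsilon>0$ there is an integer $r\ge 1$ such that the set $$\{u\in F^n : \mu(B\cap T^{\varphi(u)}B)>\mu(B)^2-\varepsilon\}$$ is an almost $\mathrm{IP}^*_r$ subset of the additive group $F^n$. -/

import Mathlib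

open MeasureTheory Filter Topology
open scoped ENNReal Pointwise

/-- The finite sums set `FS(x₁, …, x_r)`: all sums over non-empty sets of indices. -/
def finiteSums {G : Type*} [AddCommGroup G] {r : ℕ} (x : Fin r → G) : Set G :=
  {g | ∃ α : Finset (Fin r), α.Nonempty ∧ g = ∑ i ∈ α, x i}

/-- `S` is an IP_r set: it contains some `FS(x₁, …, x_r)`. -/
def IsIPSet {G : Type*} [AddCommGroup G] (r : ℕ) (S : Set G) : Prop :=
  ∃ x : Fin r → G, finiteSums x ⊆ S

/-- `A` is IP*_r: it meets every IP_r set. -/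
def IsIPStar {G : Type*} [AddCommGroup G] (r : ℕ) (A : Set G) : Prop :=
  ∀ S : Set G, IsIPSet r S → (A ∩ S).Nonempty

/-- A Følner sequence of finite non-empty subsets of `G`. -/
structure IsFolnerSeq {G : Type*} [AddCommGroup G] (Φ : ℕ → Finset G) : Prop where
  nonempty : ∀ N, (Φ N).Nonempty
  tendsto : ∀ g : G, Tendsto
    (fun N => ((((g + ·) '' (Φ N : Set G)) ∩ (Φ N : Set G)).ncard : ℝ) / ((Φ N).card : ℝ))
    atTop (𝓝 1)

/-- The upper density of `S` along the sequence `Φ`. -/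
noncomputable def upperDensityAlong {G : Type*} (Φ : ℕ → Finset G) (S : Set G) : ℝ≥0∞ :=
  limsup (fun N => ((S ∩ (Φ N : Set G)).ncard : ℝ≥0∞) / ((Φ N).card : ℝ≥0∞)) atTop

/-- The upper Banach density: the supremum of the upper densities along all Følner sequences. -/
noncomputable def upperBanachDensity {G : Type*} [AddCommGroup G] (S : Set G) : ℝ≥0∞ :=
  ⨆ (Φ : ℕ → Finset G) (_ : IsFolnerSeq Φ), upperDensityAlong Φ S

/-- `S` is almost IP*_r: an IP*_r set with a set of zero upper Banach density removed. -/
def IsAlmostIPStar {G : Type*} [AddCommGroup G] (r : ℕ) (S : Set G) : Prop :=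
  ∃ A E : Set G, IsIPStar r A ∧ upperBanachDensity E = 0 ∧ S = A \ E

/-- A monomial map `Fⁿ → F`, `x ↦ a x₁^{d₁} ⋯ x_n^{d_n}` with the `d_i ≥ 0` not all zero. -/
def IsMonomialMap {F : Type*} [Field F] {n : ℕ} (m : (Fin n → F) → F) : Prop :=
  ∃ (a : F) (d : Fin n → ℕ), (∃ i, d i ≠ 0) ∧ ∀ x, m x = a * ∏ i, x i ^ d i

/-- A polynomial map `Fⁿ → W`: a linear combination of vectors with monomial coefficients. -/
def IsPolynomialMap {F W : Type*} [Field F] [AddCommGroup W] [Module F W] {n : ℕ}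
    (φ : (Fin n → F) → W) : Prop :=
  ∃ (k : ℕ) (m : Fin k → (Fin n → F) → F) (w : Fin k → W),
    (∀ j, IsMonomialMap (m j)) ∧ ∀ x, φ x = ∑ j, m j x • w j

/-!
The action of `W` on `L²(μ)` is a unitary representation `T`, and `μ (B ∩ (φ u +ᵥ B))` is the matrix
coefficient `⟪f, T (φ u) f⟫` of the indicator function `f` of `B`. Over a finite field every long
system of finite sums contains `0`, where this coefficient is `μ B`. Over an infinite field, `f` is
split as `g + h`, with `g` in the closed span of the eigenvectors along `φ` (vectors on which all
`T (φ u)` act by scalars `χ (φ u)`, `χ` a character of `W`) and `h` orthogonal to them. Since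
constants are eigenvectors, `‖g‖ ≥ μ B`.

* For `g`, it suffices that finitely many phases `χ (φ u)` are simultaneously close to `1` on an
  IP*_r set. The maps `χ ∘ φ` are difference polynomials in the sense of abelian groups, and
  `uniformRecurrence` proves a recurrence theorem for such maps with values in a totally bounded
  group, by induction on the degree and the pigeonhole principle.

* For `h`, the averages of `|⟪h, T (φ u) h⟫|²` along any Følner sequence tend to zero, so that the
  coefficient is small outside a set of zero upper Banach density. By the spectral theorem
  (`IsUnitaryRep.exists_spectral_measure`) this follows from `constant_or_tendsto_folnerAvg`: for a
  character `χ`, the phase `χ ∘ φ` is either constant or has zero average along every Følner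
  sequence. A class of characters that agree on the values of `φ` and has positive spectral measure
  would yield an eigenvector correlated with `h` (`IsUnitaryRep.integral_class_eq_zero`).

The dichotomy for phases is where the field structure enters. By the van der Corput inequality and
induction on the degree, one may assume that the directions in which the phase `q` has a constant
difference form a subgroup of finite index. Then `q` must be additive up to a constant
(`IsPlanePoly.additive_of_finiteIndex`), and a nonconstant additive phase has zero average.
Additivity is proved by restricting `q` to planes, where it is a sum of terms `N (tⁱ yʲ)` with `N`
additive. Monomials whose exponents differ by a power of the characteristic exponent `p` can cancel,
since `y ↦ N (y^p)` is again additive; `sum_frobenius_class_eq_zero` shows that these are the only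
cancellations, and `sum_ratio_eq_zero`, an interpolation argument, passes from `t` in a
finite-index subgroup to all `t`.
-/

/-! ### Maps with vanishing iterated differences -/

/-- `f : G → A` is a difference polynomial of degree at most `d`: every `(d + 1)`-fold iterated
difference of `f` vanishes. Degree `0` means constant. -/
def IsDiffPoly {G A : Type*} [AddCommGroup G] [AddCommGroup A] : ℕ → (G → A) → Prop
  | 0, f => ∀ u v, f u = f v
  | d + 1, f => ∀ h, IsDiffPoly d (fwdDiff h f)

namespace IsDiffPoly

variable {G A A' R : Type*} [AddCommGroup G] [AddCommGroup A] [AddCommGroup A'] [CommRing R]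

theorem const (a : A) : ∀ d, IsDiffPoly d (fun _ : G => a)
  | 0 => fun _ _ => rfl
  | d + 1 => fun h => by
    have : fwdDiff h (fun _ : G => a) = fun _ => 0 := by ext; simp [fwdDiff]
    rw [this]; exact const 0 d

theorem succ : ∀ {d : ℕ} {f : G → A}, IsDiffPoly d f → IsDiffPoly (d + 1) f
  | 0, f, hf => fun h => by
    have : fwdDiff h f = fun _ => 0 := by ext u; simp [fwdDiff, hf (u + h) u]
    rw [this]; exact const 0 0
  | _ + 1, _, hf => fun h => succ (hf h)

theorem mono {d e : ℕ} (hde : d ≤ e) {f : G → A} (hf : IsDiffPoly d f) : IsDiffPoly e f := by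
  induction hde with
  | refl => exact hf
  | step _ ih => exact ih.succ

theorem add : ∀ {d : ℕ} {f g : G → A}, IsDiffPoly d f → IsDiffPoly d g →
    IsDiffPoly d (fun u => f u + g u)
  | 0, _, _, hf, hg => fun u v => by simp only [hf u v, hg u v]
  | d + 1, f, g, hf, hg => fun h => by
    have : fwdDiff h (fun u => f u + g u) = fun u => fwdDiff h f u + fwdDiff h g u := by
      ext u; simp only [fwdDiff]; abel
    rw [this]; exact (hf h).add (hg h)

theorem map (L : A →+ A') : ∀ {d : ℕ} {f : G → A}, IsDiffPoly d f →
    IsDiffPoly d (fun u => L (f u))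
  | 0, _, hf => fun u v => by simp only [hf u v]
  | d + 1, f, hf => fun h => by
    have : fwdDiff h (fun u => L (f u)) = fun u => L (fwdDiff h f u) := by
      ext u; simp only [fwdDiff, map_sub]
    rw [this]; exact map L (hf h)

theorem sub {d : ℕ} {f g : G → A} (hf : IsDiffPoly d f) (hg : IsDiffPoly d g) :
    IsDiffPoly d (fun u => f u - g u) := by
  simpa [sub_eq_add_neg] using hf.add (hg.map (-AddMonoidHom.id A))

theorem shift (c : G) : ∀ {d : ℕ} {f : G → A}, IsDiffPoly d f → IsDiffPoly d (fun u => f (u + c))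
  | 0, _, hf => fun u v => hf _ _
  | d + 1, f, hf => fun h => by
    have : fwdDiff h (fun u => f (u + c)) = fun u => fwdDiff h f (u + c) := by
      ext u; simp only [fwdDiff, add_right_comm]
    rw [this]; exact shift c (hf h)

theorem mul {d e : ℕ} {f g : G → R} (hf : IsDiffPoly d f) (hg : IsDiffPoly e g) :
    IsDiffPoly (d + e) (fun u => f u * g u) := by
  induction hs : d + e generalizing d e f g with
  | zero =>
    obtain ⟨rfl, rfl⟩ : d = 0 ∧ e = 0 := by omega
    exact fun u v => by simp only [hf u v, hg u v]
  | succ s ih =>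
    intro h
    have : fwdDiff h (fun u => f u * g u) =
        fun u => fwdDiff h f u * g (u + h) + f u * fwdDiff h g u := by
      ext u; simp only [fwdDiff]; ring
    rw [this]
    refine add ?_ ?_
    · cases d with
      | zero =>
        have h0 : fwdDiff h f = fun _ => 0 := by ext u; simp [fwdDiff, hf (u + h) u]
        simpa [h0] using const 0 s
      | succ d => exact ih (hf h) (hg.shift h) (by omega)
    · cases e with
      | zero =>
        have h0 : fwdDiff h g = fun _ => 0 := by ext u; simp [fwdDiff, hg (u + h) u]
        simpa [h0] using const 0 s
      | succ e => exact ih hf (hg h) (by omega)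

theorem exists_sum {ι : Type*} (s : Finset ι) (f : ι → G → A)
    (hf : ∀ i, ∃ d, IsDiffPoly d (f i)) : ∃ d, IsDiffPoly d (fun u => ∑ i ∈ s, f i u) := by
  classical
  induction s using Finset.induction_on with
  | empty => exact ⟨0, by simpa using const 0 0⟩
  | insert a s ha ih =>
    obtain ⟨d, hd⟩ := ih
    obtain ⟨e, he⟩ := hf a
    refine ⟨d + e, ?_⟩
    simp only [Finset.sum_insert ha]
    exact (he.mono (by omega)).add (hd.mono (by omega))

theorem exists_prod {ι : Type*} (s : Finset ι) (f : ι → G → R)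
    (hf : ∀ i, ∃ d, IsDiffPoly d (f i)) : ∃ d, IsDiffPoly d (fun u => ∏ i ∈ s, f i u) := by
  classical
  induction s using Finset.induction_on with
  | empty => exact ⟨0, by simpa using const 1 0⟩
  | insert a s ha ih =>
    obtain ⟨d, hd⟩ := ih
    obtain ⟨e, he⟩ := hf a
    refine ⟨e + d, ?_⟩
    simp only [Finset.prod_insert ha]
    exact he.mul hd

theorem of_addMonoidHom (L : G →+ A) : IsDiffPoly 1 L := fun h u v => by
  simp [fwdDiff]

end IsDiffPoly

/-- A polynomial map over a field is a difference polynomial. -/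
theorem IsPolynomialMap.exists_isDiffPoly {F W : Type*} [Field F] [AddCommGroup W] [Module F W]
    {n : ℕ} {φ : (Fin n → F) → W} (hφ : IsPolynomialMap φ) : ∃ d, IsDiffPoly d φ := by
  obtain ⟨k, m, w, hm, h⟩ := hφ
  have : φ = fun x => ∑ j, m j x • w j := funext h
  rw [this]
  refine IsDiffPoly.exists_sum _ _ fun j => ?_
  obtain ⟨a, e, -, hme⟩ := hm j
  have h1 : ∃ d, IsDiffPoly d (fun x : Fin n → F => ∏ i, ∏ _l ∈ Finset.range (e i), x i) :=
    IsDiffPoly.exists_prod _ _ fun i => IsDiffPoly.exists_prod _ _ fun _ =>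
      ⟨1, IsDiffPoly.of_addMonoidHom (Pi.evalAddMonoidHom (fun _ => F) i)⟩
  obtain ⟨d, hd⟩ := h1
  refine ⟨d, ?_⟩
  have := hd.map
    ((LinearMap.toSpanSingleton F W (w j)).toAddMonoidHom.comp (AddMonoidHom.mulLeft a))
  simpa [hme] using this

theorem IsPolynomialMap.map_zero {F W : Type*} [Field F] [AddCommGroup W] [Module F W]
    {n : ℕ} {φ : (Fin n → F) → W} (hφ : IsPolynomialMap φ) : φ 0 = 0 := by
  obtain ⟨k, m, w, hm, h⟩ := hφ
  rw [h]
  refine Finset.sum_eq_zero fun j _ => ?_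
  obtain ⟨a, e, ⟨i, hi⟩, hme⟩ := hm j
  rw [hme, Finset.prod_eq_zero (Finset.mem_univ i) (by simp [hi]), mul_zero, zero_smul]

/-! ### Finitary recurrence of difference polynomials in totally bounded groups -/

/-- `ν` is a length function on `A` for which `A` is totally bounded: for every `ε` there is a
finite colouring of `A` each of whose classes has `ν`-diameter less than `ε`. -/
structure IsTotallyBoundedLength {A : Type*} [AddCommGroup A] (ν : A → ℝ) : Prop where
  map_zero : ν 0 = 0
  add_le : ∀ a b, ν (a + b) ≤ ν a + ν b
  exists_coloring : ∀ ε > 0, ∃ (m : ℕ) (c : A → Fin m), ∀ a b, c a = c b → ν (a - b) < ε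

section Recurrence

variable {G A : Type*} [AddCommGroup G] [AddCommGroup A] {ν : A → ℝ}

/-- The recurrence property in degree `d`, uniform in the maps and in the sequence `x`. -/
def UniformRecurrence (G : Type*) {A : Type*} [AddCommGroup G] [AddCommGroup A] (ν : A → ℝ)
    (d : ℕ) : Prop :=
  ∀ (ι : Type) [Fintype ι] (ε : ℝ), 0 < ε → ∃ r : ℕ, ∀ f : ι → G → A,
    (∀ i, IsDiffPoly d (f i)) → (∀ i, f i 0 = 0) → ∀ x : ℕ → G,
    ∃ α ⊆ Finset.range r, α.Nonempty ∧ ∀ i, ν (f i (∑ l ∈ α, x l)) < ε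

/-- Recurrence in degree `d` produces `y₀, …, y_{k-1}` whose sums over intervals are finite sums
of `x` and on which every `f a`, of degree `d + 1`, is nearly additive. -/
theorem UniformRecurrence.exists_nearly_additive (hν : IsTotallyBoundedLength ν) {d : ℕ}
    (hd : UniformRecurrence G ν d) (ι : Type) [Fintype ι] {δ : ℝ} (hδ : 0 < δ) (k : ℕ) :
    ∃ r : ℕ, ∀ f : ι → G → A, (∀ i, IsDiffPoly (d + 1) (f i)) → (∀ i, f i 0 = 0) →
    ∀ x : ℕ → G, ∃ y : ℕ → G, ∀ i j, i < j → j ≤ k →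
      (∃ α ⊆ Finset.range r, α.Nonempty ∧ ∑ l ∈ Finset.Ico i j, y l = ∑ l ∈ α, x l) ∧
      ∀ a, ν (f a (∑ l ∈ Finset.Ico i j, y l) - ∑ l ∈ Finset.Ico i j, f a (y l)) ≤ k * δ := by
  induction k with
  | zero => exact ⟨0, fun f _ _ x => ⟨0, fun i j h1 h2 => by omega⟩⟩
  | succ k ih =>
    obtain ⟨r, hr⟩ := ih
    obtain ⟨r', hr'⟩ := hd (ι × Fin (k + 1)) δ hδ
    refine ⟨r + r', fun f hf hf0 x => ?_⟩
    obtain ⟨y, hy⟩ := hr f hf hf0 x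
    -- The new element is chosen so that its cross terms with all earlier interval sums are small.
    set t : ℕ → G := fun i => ∑ l ∈ Finset.Ico i k, y l with ht
    obtain ⟨β, hβ, hβn, hβs⟩ := hr' (fun p v => fwdDiff (t p.2) (f p.1) v - f p.1 (t p.2))
      (fun p => (hf p.1 (t p.2)).sub (IsDiffPoly.const _ _))
      (fun p => by simp [fwdDiff, hf0]) (fun l => x (r + l))
    set v := ∑ l ∈ β, x (r + l) with hv
    have hvβ : v = ∑ l ∈ β.map (addLeftEmbedding r), x l := by simp [hv]
    have hβ' : β.map (addLeftEmbedding r) ⊆ Finset.range (r + r') := by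
      intro l hl
      obtain ⟨l', hl', rfl⟩ := Finset.mem_map.1 hl
      have := Finset.mem_range.1 (hβ hl')
      simp; omega
    have hold : ∀ i j, j ≤ k → ∑ l ∈ Finset.Ico i j, Function.update y k v l =
        ∑ l ∈ Finset.Ico i j, y l := fun i j hj => Finset.sum_congr rfl fun l hl => by
      rw [Function.update_of_ne (by have := Finset.mem_Ico.1 hl; omega)]
    have hold' : ∀ a i j, j ≤ k → ∑ l ∈ Finset.Ico i j, f a (Function.update y k v l) =
        ∑ l ∈ Finset.Ico i j, f a (y l) := fun a i j hj => Finset.sum_congr rfl fun l hl => by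
      rw [Function.update_of_ne (by have := Finset.mem_Ico.1 hl; omega)]
    refine ⟨Function.update y k v, fun i j hij hj => ?_⟩
    rcases Nat.lt_or_ge k j with hkj | hjk
    · obtain rfl : j = k + 1 := by omega
      have hik : i ≤ k := by omega
      have hnew : ∑ l ∈ Finset.Ico i (k + 1), Function.update y k v l = t i + v := by
        rw [Finset.sum_Ico_succ_top hik, hold i k le_rfl, Function.update_self]
      have hcross : ∀ a, ν (f a (t i + v) - f a v - f a (t i)) < δ := fun a => by
        have := hβs (a, ⟨i, by omega⟩)
        simpa [fwdDiff, add_comm] using this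
      constructor
      · rw [hnew, hvβ]
        rcases hik.lt_or_eq with hlt | rfl
        · obtain ⟨⟨α, hα, hαn, hαs⟩, -⟩ := hy i k hlt le_rfl
          refine ⟨α ∪ β.map (addLeftEmbedding r), ?_, hαn.mono Finset.subset_union_left, ?_⟩
          · exact Finset.union_subset (hα.trans (by simp)) hβ'
          · rw [Finset.sum_union, ht]
            · exact congrArg (· + _) hαs
            · rw [Finset.disjoint_left]
              intro l hl hl'
              obtain ⟨l', -, rfl⟩ := Finset.mem_map.1 hl'
              have := Finset.mem_range.1 (hα hl)
              simp at this
        · exact ⟨_, hβ', hβn.map, by simp [ht]⟩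
      · intro a
        rw [hnew, Finset.sum_Ico_succ_top hik, hold' a i k le_rfl, Function.update_self]
        have h1 : ν (f a (t i) - ∑ l ∈ Finset.Ico i k, f a (y l)) ≤ k * δ := by
          rcases hik.lt_or_eq with hlt | rfl
          · exact (hy i k hlt le_rfl).2 a
          · simp only [ht, Finset.Ico_self, Finset.sum_empty, hf0, sub_zero, hν.map_zero]
            positivity
        calc ν (f a (t i + v) - (∑ l ∈ Finset.Ico i k, f a (y l) + f a v))
            = ν ((f a (t i + v) - f a v - f a (t i)) +
                (f a (t i) - ∑ l ∈ Finset.Ico i k, f a (y l))) := by congr 1; abel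
          _ ≤ δ + k * δ := (hν.add_le _ _).trans (add_le_add (hcross a).le h1)
          _ = ((k + 1 : ℕ) : ℝ) * δ := by push_cast; ring
    · obtain ⟨⟨α, hα, hαn, hαs⟩, h2⟩ := hy i j hij hjk
      refine ⟨⟨α, hα.trans (by simp), hαn, by rw [hold i j hjk, hαs]⟩, fun a => ?_⟩
      rw [hold i j hjk, hold' a i j hjk]
      refine (h2 a).trans ?_
      gcongr; simp

/-- Difference polynomials vanishing at `0` with values in a totally bounded group recur along
every sufficiently long system of finite sums. Pigeonhole applies to the partial sums of the
values of `f` at a nearly additive sequence. -/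
theorem uniformRecurrence (hν : IsTotallyBoundedLength ν) (d : ℕ) : UniformRecurrence G ν d := by
  induction d with
  | zero =>
    intro ι _ ε hε
    refine ⟨1, fun f hf hf0 x => ⟨{0}, by simp, by simp, fun i => ?_⟩⟩
    rw [hf i _ 0, hf0, hν.map_zero]
    exact hε
  | succ d ih =>
    intro ι _ ε hε
    classical
    obtain ⟨m, c, hc⟩ := hν.exists_coloring (ε / 2) (by positivity)
    set k := Fintype.card (ι → Fin m) with hk
    obtain ⟨r, hr⟩ := ih.exists_nearly_additive hν ι (δ := ε / (2 * (k + 1))) (by positivity) k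
    refine ⟨r, fun f hf hf0 x => ?_⟩
    obtain ⟨y, hy⟩ := hr f hf hf0 x
    obtain ⟨i, j, hij, hcij⟩ := Fintype.exists_ne_map_eq_of_card_lt
      (fun (j : Fin (k + 1)) (a : ι) => c (∑ l ∈ Finset.range j, f a (y l)))
      (by rw [Fintype.card_fin, ← hk]; omega)
    wlog hlt : i < j generalizing i j
    · exact this j i hij.symm hcij.symm (lt_of_le_of_ne (not_lt.1 hlt) hij.symm)
    obtain ⟨⟨α, hα, hαn, hαs⟩, h2⟩ := hy i j hlt (by omega)
    refine ⟨α, hα, hαn, fun a => ?_⟩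
    rw [← hαs]
    have h3 : ν (∑ l ∈ Finset.Ico (i : ℕ) j, f a (y l)) < ε / 2 := by
      rw [Finset.sum_Ico_eq_sub _ (le_of_lt hlt)]
      exact hc _ _ (congrFun hcij a).symm
    have h4 : (k : ℝ) * (ε / (2 * (k + 1))) ≤ ε / 2 := by
      rw [← mul_div_assoc, div_le_div_iff₀ (by positivity) (by positivity)]
      nlinarith
    calc ν (f a (∑ l ∈ Finset.Ico (i : ℕ) j, y l))
        = ν ((f a (∑ l ∈ Finset.Ico (i : ℕ) j, y l) - ∑ l ∈ Finset.Ico (i : ℕ) j, f a (y l)) +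
            ∑ l ∈ Finset.Ico (i : ℕ) j, f a (y l)) := by rw [sub_add_cancel]
      _ ≤ _ := hν.add_le _ _
      _ < ε := by linarith [h2 a]

/-- The set of `ε`-returns of finitely many difference polynomials is IP*_r for some `r`. -/
theorem exists_isIPStar_returns (hν : IsTotallyBoundedLength ν) {d : ℕ} (ι : Type) [Fintype ι]
    (f : ι → G → A) (hf : ∀ i, IsDiffPoly d (f i)) (hf0 : ∀ i, f i 0 = 0) {ε : ℝ} (hε : 0 < ε) :
    ∃ r : ℕ, 1 ≤ r ∧ IsIPStar r {u | ∀ i, ν (f i u) < ε} := by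
  obtain ⟨r, hr⟩ := uniformRecurrence (G := G) hν d ι ε hε
  refine ⟨r + 1, by omega, fun S ⟨x, hx⟩ => ?_⟩
  obtain ⟨α, hα, hαn, h⟩ := hr f hf hf0 (fun l => if hl : l < r + 1 then x ⟨l, hl⟩ else 0)
  refine ⟨_, h, hx ⟨Finset.univ.filter fun i : Fin (r + 1) => (i : ℕ) ∈ α, ?_, ?_⟩⟩
  · obtain ⟨l, hl⟩ := hαn
    have := Finset.mem_range.1 (hα hl)
    exact ⟨⟨l, by omega⟩, by simpa using hl⟩
  · symm
    refine Finset.sum_bij (fun i _ => (i : ℕ)) (by simp) (fun i _ j _ h => Fin.ext h) ?_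
      (fun i _ => by rw [dif_pos i.2])
    intro l hl
    have := Finset.mem_range.1 (hα hl)
    exact ⟨⟨l, by omega⟩, by simpa using hl, rfl⟩

end Recurrence

/-! ### Additive relations between powers in an infinite field -/

section Algebra

variable {F A : Type*} [Field F] [AddCommGroup A]

/-- Finite weights on an infinite set of nodes that read off the coefficient of degree `s₀` of a
polynomial of degree less than `D`. -/
theorem exists_coeff_weights {T : Set F} (hT : T.Infinite) (D s₀ : ℕ) :
    ∃ (T' : Finset F) (c : F → F), (↑T' ⊆ T) ∧
      ∀ s < D, ∑ τ ∈ T', c τ * τ ^ s = if s = s₀ then 1 else 0 := by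
  classical
  obtain ⟨T', hT', hcard⟩ := hT.exists_subset_card_eq D
  refine ⟨T', fun τ => (Lagrange.basis T' id τ).coeff s₀, hT', fun s hs => ?_⟩
  have h := Lagrange.eq_interpolate (s := T') (v := (id : F → F)) (f := Polynomial.X ^ s)
    (Set.injOn_id _) (by rw [Polynomial.degree_X_pow, hcard]; exact_mod_cast hs)
  have h2 := congrArg (fun P => Polynomial.coeff P s₀) h
  simp only [Lagrange.interpolate_apply, Polynomial.finsetSum_coeff, Polynomial.coeff_C_mul,
    Polynomial.coeff_X_pow, Polynomial.eval_pow, Polynomial.eval_X, id] at h2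
  simp only [mul_comm _ (_ ^ s), ← h2, eq_comm]

/-- A relation `∑ N (tⁱ y^(p^k)) = 0` valid for all `y` and for `t` in a large set splits into its
parts with a fixed ratio `i / p^k`, and these hold for all `t`: substitute
`t = c τ^(p^K)` and `λ y` for `y`, and sum over nodes `τ` with weights `λ`; additivity of
`y ↦ y^(p^k)` turns the sum into `(∑ λ τ^s)^(p^k)` with `s = p^(K-k) i`. -/
theorem sum_ratio_eq_zero (p : ℕ) [ExpChar F p] {Λ : Set F} (J : Finset (ℕ × ℕ)) (K : ℕ)
    (hK : ∀ x ∈ J, x.2 ≤ K) (hΛ : ∀ c : F, {τ : F | c * τ ^ p ^ K ∈ Λ}.Infinite)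
    (N : ℕ × ℕ → F →+ A) (hN : ∀ t ∈ Λ, ∀ y, ∑ x ∈ J, N x (t ^ x.1 * y ^ p ^ x.2) = 0)
    (s₀ : ℕ) (c y : F) :
    ∑ x ∈ J with p ^ (K - x.2) * x.1 = s₀, N x (c ^ x.1 * y ^ p ^ x.2) = 0 := by
  obtain ⟨T, w, hT, hw⟩ := exists_coeff_weights (hΛ c)
    ((J.sup fun x => p ^ (K - x.2) * x.1) + 1) s₀
  have hpow : ∀ x ∈ J, ∑ τ ∈ T, (c * τ ^ p ^ K) ^ x.1 * (w τ * y) ^ p ^ x.2 =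
      if p ^ (K - x.2) * x.1 = s₀ then c ^ x.1 * y ^ p ^ x.2 else 0 := by
    intro x hx
    have h1 : ∀ τ, (c * τ ^ p ^ K) ^ x.1 * (w τ * y) ^ p ^ x.2 =
        c ^ x.1 * y ^ p ^ x.2 * iterateFrobenius F p x.2 (w τ * τ ^ (p ^ (K - x.2) * x.1)) := by
      intro τ
      have h2 : p ^ K = p ^ (K - x.2) * p ^ x.2 := by
        rw [← pow_add, Nat.sub_add_cancel (hK x hx)]
      rw [iterateFrobenius_def, h2]
      ring
    rw [Finset.sum_congr rfl fun τ _ => h1 τ, ← Finset.mul_sum, ← map_sum,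
      hw _ (Nat.lt_succ_of_le (Finset.le_sup (f := fun x : ℕ × ℕ => p ^ (K - x.2) * x.1) hx))]
    split_ifs <;> simp
  rw [Finset.sum_filter]
  calc _ = ∑ x ∈ J, N x (∑ τ ∈ T, (c * τ ^ p ^ K) ^ x.1 * (w τ * y) ^ p ^ x.2) := by
        refine Finset.sum_congr rfl fun x hx => ?_
        rw [hpow x hx]; split_ifs <;> simp
    _ = ∑ τ ∈ T, ∑ x ∈ J, N x ((c * τ ^ p ^ K) ^ x.1 * (w τ * y) ^ p ^ x.2) := by
        simp only [map_sum]; exact Finset.sum_comm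
    _ = 0 := Finset.sum_eq_zero fun τ hτ => hN _ (hT hτ) _

theorem cast_choose_expChar_pow (p : ℕ) [hp : ExpChar F p] (a x : ℕ) :
    ((Nat.choose (p ^ a * x) (p ^ a) : ℕ) : F) = x := by
  cases hp with
  | zero => simp
  | prime hp =>
    have := Fact.mk hp
    induction a with
    | zero => simp
    | succ a ih =>
      rw [← ih, CharP.cast_eq_iff_mod_eq F p]
      have := Choose.choose_modEq_choose_mod_mul_choose_div_nat (n := p ^ (a + 1) * x)
        (k := p ^ (a + 1)) (p := p)
      rw [pow_succ', mul_assoc, Nat.mul_mod_right, Nat.mul_mod_right,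
        Nat.mul_div_cancel_left _ hp.pos, Nat.mul_div_cancel_left _ hp.pos] at this
      rw [pow_succ', mul_assoc]
      simpa [Nat.ModEq] using this

/-- With this `κ`, every positive number below `D` is uniquely of the form `g p^k` with `k < κ` and
`g` nonzero in a field of characteristic exponent `p`. In
characteristic zero (`p = 1`) only `k = 0` is allowed, so that no exponent is counted twice. -/
def IsFrobBound (p D κ : ℕ) : Prop := (p = 1 ∧ κ = 1) ∨ (p.Prime ∧ D ≤ κ)

theorem IsFrobBound.mono {p D D' κ : ℕ} (h : IsFrobBound p D κ) (hD : D' ≤ D) :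
    IsFrobBound p D' κ := h.imp id fun h => ⟨h.1, hD.trans h.2⟩

theorem exists_isFrobBound (F : Type*) [Field F] (p D : ℕ) [hp : ExpChar F p] :
    ∃ κ, IsFrobBound p D κ := by
  cases hp with
  | zero => exact ⟨1, .inl ⟨rfl, rfl⟩⟩
  | prime hp => exact ⟨D, .inr ⟨hp, le_rfl⟩⟩

/-- Every positive `j < D` is `g p^k` with `g` nonzero in `F` and `k < κ`. -/
theorem exists_eq_mul_pow (p : ℕ) [hp : ExpChar F p] {D κ : ℕ} (hκ : IsFrobBound p D κ) {j : ℕ}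
    (hj : 0 < j) (hjD : j < D) : ∃ g k : ℕ, (g : F) ≠ 0 ∧ k < κ ∧ j = g * p ^ k := by
  cases hp with
  | zero =>
    rcases hκ with ⟨-, rfl⟩ | ⟨h, -⟩
    · exact ⟨j, 0, by exact_mod_cast hj.ne', one_pos, by simp⟩
    · exact absurd h Nat.not_prime_one
  | prime hp =>
    rcases hκ with ⟨h, -⟩ | ⟨-, hκ⟩
    · exact absurd h hp.one_lt.ne'
    · obtain ⟨k, g, hg, rfl⟩ := Nat.exists_eq_pow_mul_and_not_dvd hj.ne' p hp.ne_one
      refine ⟨g, k, by rwa [Ne, CharP.cast_eq_zero_iff F p], ?_, mul_comm _ _⟩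
      have h1 : k < p ^ k := Nat.lt_pow_self hp.one_lt
      have h2 : p ^ k ≤ p ^ k * g := Nat.le_mul_of_pos_right _ (Nat.pos_of_mul_pos_left hj)
      omega

theorem mul_pow_injective (p : ℕ) [hp : ExpChar F p] {D κ : ℕ} (hκ : IsFrobBound p D κ)
    {g g' k k' : ℕ} (hg : (g : F) ≠ 0) (hg' : (g' : F) ≠ 0) (hk : k < κ) (hk' : k' < κ)
    (h : g * p ^ k = g' * p ^ k') : g = g' ∧ k = k' := by
  cases hp with
  | zero =>
    rcases hκ with ⟨-, rfl⟩ | ⟨h, -⟩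
    · refine ⟨by simpa using h, by omega⟩
    · exact absurd h Nat.not_prime_one
  | prime hp =>
    wlog hle : k ≤ k' generalizing g g' k k'
    · exact (this hg' hg hk' hk h.symm (by omega)).imp Eq.symm Eq.symm
    obtain ⟨a, rfl⟩ := Nat.exists_eq_add_of_le hle
    have h2 : g = g' * p ^ a := by
      have : g * p ^ k = (g' * p ^ a) * p ^ k := by rw [h]; ring
      exact Nat.eq_of_mul_eq_mul_right (pow_pos hp.pos k) this
    rcases Nat.eq_zero_or_pos a with rfl | ha
    · simpa using h2
    · exfalso; apply hg
      rw [h2, CharP.cast_eq_zero_iff F p]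
      exact Dvd.dvd.mul_left (dvd_pow_self p ha.ne') _

/-- The positive exponents below `D` are partitioned by their prime-to-`p` parts. -/
theorem sum_frobenius_classes (p : ℕ) [hp : ExpChar F p] {D κ : ℕ}
    (hκ : IsFrobBound p D κ) (u : ℕ → A) (hu : ∀ j, D ≤ j → u j = 0) (hu0 : u 0 = 0)
    (S : Finset ℕ) (hS : ∀ g, g ∈ S ↔ (g : F) ≠ 0 ∧ g < D) :
    ∑ g ∈ S, ∑ k ∈ Finset.range κ, u (g * p ^ k) = ∑ j ∈ Finset.range D, u j := by
  rw [← Finset.sum_product']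
  refine Finset.sum_bij_ne_zero (fun x _ _ => x.1 * p ^ x.2) ?_ ?_ ?_ (fun _ _ _ => rfl)
  · intro x _ hx
    by_contra hlt
    exact hx (hu _ (by simpa using hlt))
  · intro x hx _ y hy _ hxy
    simp only [Finset.mem_product, hS, Finset.mem_range] at hx hy
    exact Prod.ext_iff.2 (mul_pow_injective p hκ hx.1.1 hy.1.1 hx.2 hy.2 hxy)
  · intro j hj hj0
    obtain ⟨g, k, hg, hk, rfl⟩ := exists_eq_mul_pow (F := F) p hκ
      (Nat.pos_of_ne_zero fun h => hj0 (by rw [h, hu0])) (Finset.mem_range.1 hj)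
    have : 0 < p ^ k := pow_pos (expChar_pos F p) k
    have hgD : g < D := lt_of_le_of_lt (Nat.le_mul_of_pos_right g this) (Finset.mem_range.1 hj)
    exact ⟨(g, k), by simp [hS, hg, hgD, hk], hj0, rfl⟩

/-- The second difference of `y ↦ ∑ N_j (y^j)` as a sum over mixed monomials. -/
theorem sum_mixed_eq_zero {D : ℕ} (N : ℕ → F →+ A) (hD : ∀ j, D + 1 ≤ j → N j = 0)
    (h : ∀ y, ∑ j ∈ Finset.range (D + 1), N j (y ^ j) = 0) (x y : F) :
    ∑ a ∈ Finset.Ico 1 (D + 1), ∑ b ∈ Finset.Ico 1 (D + 1),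
      N (a + b) (((a + b).choose a : F) * (x ^ b * y ^ a)) = 0 := by

  have hfull : ∑ a ∈ Finset.range (D + 1), ∑ b ∈ Finset.range (D + 1),
      N (a + b) (((a + b).choose a : F) * (x ^ b * y ^ a)) = 0 := by
    rw [← h (y + x)]
    have h1 : ∀ j, N j ((y + x) ^ j) = ∑ ab ∈ Finset.HasAntidiagonal.antidiagonal j,
        N (ab.1 + ab.2) (((ab.1 + ab.2).choose ab.1 : F) * (x ^ ab.2 * y ^ ab.1)) := fun j => by
      rw [Commute.add_pow' (Commute.all y x), map_sum]
      refine Finset.sum_congr rfl fun ab hab => ?_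
      rw [Finset.HasAntidiagonal.mem_antidiagonal.1 hab, nsmul_eq_mul, mul_comm (x ^ _)]
    simp only [h1]
    rw [← Finset.sum_product', Finset.sum_sigma']
    symm
    refine Finset.sum_bij_ne_zero (fun s _ _ => s.2) ?_ ?_ ?_ (fun _ _ _ => rfl)
    · rintro ⟨j, a, b⟩ hs _
      simp at hs ⊢
      omega
    · rintro ⟨j, ab⟩ hs _ ⟨j', ab'⟩ hs' _ rfl
      simp at hs hs'
      obtain ⟨-, rfl⟩ := hs
      obtain ⟨-, rfl⟩ := hs'
      rfl
    · rintro ⟨a, b⟩ hs hne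
      refine ⟨⟨a + b, a, b⟩, ?_, hne, rfl⟩
      have : a + b < D + 1 := by
        by_contra hlt
        exact hne (by simp [hD (a + b) (by omega)])
      simp; omega
  have h0 : ∀ z, ∑ b ∈ Finset.range D, N (b + 1) (z ^ (b + 1)) + N 0 1 = 0 := fun z => by
    have := h z
    rwa [Finset.sum_range_succ', pow_zero] at this
  have hN0 : N 0 1 = 0 := by simpa using h0 0
  simp only [Finset.range_eq_Ico] at hfull h0
  rw [Finset.sum_eq_sum_Ico_succ_bot (by omega)] at hfull
  simp_rw [Finset.sum_eq_sum_Ico_succ_bot (Nat.succ_pos D)] at hfull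
  rw [Finset.sum_add_distrib] at hfull
  have e1 : ∀ z, ∑ b ∈ Finset.Ico 1 (D + 1), N b (z ^ b) = 0 := fun z => by
    have := h z
    rw [Finset.range_eq_Ico, Finset.sum_eq_sum_Ico_succ_bot (by omega), pow_zero, hN0,
      zero_add] at this
    exact this
  simpa [hN0, e1] using hfull

/-- If `∑ N_j (y^j)` vanishes identically, so does the part with exponents in `(g + 1) p^ℕ`,
for `g ≥ 1` and `g + 1` prime to the characteristic. The mixed part of
`∑ N_j ((y + x)^j)` is, for fixed `x`, a relation of lower degree; the hypothesis `ih` extracts its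
part with exponents in `f p^ℕ`, where `g = f p^m`, and `sum_ratio_eq_zero` extracts from that the
monomials `x^(p^(k-m)) y^(f p^k)`. -/
theorem sum_frobenius_class_eq_zero_of_two_le [Infinite F] (p : ℕ) [hp : ExpChar F p] {κ : ℕ}
    (D : ℕ) (hκ : IsFrobBound p D κ)
    (ih : ∀ D' < D, ∀ N : ℕ → F →+ A, (∀ j, D' ≤ j → N j = 0) →
      (∀ y, ∑ j ∈ Finset.range D', N j (y ^ j) = 0) →
      ∀ g : ℕ, (g : F) ≠ 0 → ∀ y, ∑ k ∈ Finset.range κ, N (g * p ^ k) (y ^ p ^ k) = 0)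
    (N : ℕ → F →+ A) (hD : ∀ j, D ≤ j → N j = 0)
    (h : ∀ y, ∑ j ∈ Finset.range D, N j (y ^ j) = 0) (g : ℕ) (hg : ((g + 1 : ℕ) : F) ≠ 0)
    (hg0 : 0 < g) (y : F) :
    ∑ k ∈ Finset.range κ, N ((g + 1) * p ^ k) (y ^ p ^ k) = 0 := by
  have hp0 : 0 < p := expChar_pos F p
  rcases Nat.lt_or_ge g D with hgD | hgD
  swap
  · refine Finset.sum_eq_zero fun k _ => ?_
    rw [hD, AddMonoidHom.zero_apply]
    have := Nat.le_mul_of_pos_right (g + 1) (pow_pos hp0 k)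
    omega
  obtain ⟨f, m, hf, hm, rfl⟩ := exists_eq_mul_pow (F := F) p hκ hg0 hgD
  obtain ⟨D, rfl⟩ : ∃ D', D = D' + 1 := ⟨D - 1, by omega⟩
  -- For fixed `x` the mixed part is a relation of lower degree in `y`.
  have h1 : ∀ x y : F, ∑ k ∈ Finset.range κ, ∑ b ∈ Finset.Ico 1 (D + 1),
      N (f * p ^ k + b) (((f * p ^ k + b).choose (f * p ^ k) : F) * (x ^ b * y ^ p ^ k)) = 0 := by
    intro x y
    have := ih D (by omega) (fun a => if a = 0 then 0 else ∑ b ∈ Finset.Ico 1 (D + 1),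
        (N (a + b)).comp (AddMonoidHom.mulLeft (((a + b).choose a : F) * x ^ b))) ?_ ?_ f hf y
    · rw [← this]
      refine Finset.sum_congr rfl fun k _ => ?_
      have hne : f * p ^ k ≠ 0 :=
        mul_ne_zero (fun h0 => hf (by simp [h0])) (pow_pos hp0 k).ne'
      simp [hne, AddMonoidHom.finsetSum_apply, mul_assoc]
    · intro a ha
      split_ifs
      · rfl
      · refine Finset.sum_eq_zero fun b hb => ?_
        rw [hD (a + b) (by have := Finset.mem_Ico.1 hb; omega)]
        rfl
    · intro y
      rw [← sum_mixed_eq_zero N hD h x y]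
      rcases Nat.eq_zero_or_pos D with rfl | hDpos
      · simp
      have e2 : ∑ b ∈ Finset.Ico 1 (D + 1),
          N (D + b) (((D + b).choose D : F) * (x ^ b * y ^ D)) = 0 :=
        Finset.sum_eq_zero fun b hb => by
          rw [hD (D + b) (by have := Finset.mem_Ico.1 hb; omega)]; rfl
      rw [Finset.sum_Ico_succ_top hDpos, e2, add_zero, Finset.range_eq_Ico,
        Finset.sum_eq_sum_Ico_succ_bot hDpos]
      simp only [if_true, AddMonoidHom.zero_apply, zero_add]
      refine Finset.sum_congr rfl fun a ha => ?_
      rw [if_neg (by have := Finset.mem_Ico.1 ha; omega)]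
      simp [AddMonoidHom.finsetSum_apply, mul_assoc]
  -- The part of ratio `p^(-m)` consists of the exponents `f p^k + p^(k-m) = p^(k-m) (f p^m + 1)`.
  have h2 := sum_ratio_eq_zero p (Λ := Set.univ) (Finset.Ico 1 (D + 1) ×ˢ Finset.range κ) κ
    (by simp only [Finset.mem_product, Finset.mem_range]; intro x hx; omega)
    (by simpa using Set.infinite_univ)
    (fun x => (N (f * p ^ x.2 + x.1)).comp
      (AddMonoidHom.mulLeft ((f * p ^ x.2 + x.1).choose (f * p ^ x.2) : F)))
    (by
      intro t _ y
      rw [Finset.sum_product_right]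
      simpa using h1 t y) (p ^ (κ - m))
  have h3 : ∀ c : F, ∑ k ∈ Finset.range κ, N ((f * p ^ m + 1) * p ^ k)
      (((f * p ^ m + 1 : ℕ) : F) * c ^ p ^ k) = 0 := by
    intro c
    rw [← h2 c 1]
    refine Finset.sum_bij_ne_zero (fun k _ _ => (p ^ k, k + m)) ?_ ?_ ?_ ?_
    · intro k hk hne
      have hkD : (f * p ^ m + 1) * p ^ k < D + 1 := by
        by_contra hlt
        exact hne (by rw [hD _ (by omega)]; rfl)
      have hf1 : 0 < f := Nat.pos_of_ne_zero fun h0 => hf (by simp [h0])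
      have hkκ : k + m < κ := by
        rcases hκ with ⟨rfl, rfl⟩ | ⟨hp, hκ⟩
        · have := Finset.mem_range.1 hk; omega
        · have h4 : k + m < p ^ (k + m) := Nat.lt_pow_self hp.one_lt
          have h5 : p ^ (k + m) ≤ (f * p ^ m + 1) * p ^ k := by
            rw [pow_add]; nlinarith [Nat.le_mul_of_pos_left (p ^ m) hf1, pow_pos hp0 k]
          omega
      have h6 : p ^ k < D + 1 := lt_of_le_of_lt (Nat.le_mul_of_pos_left _ (by omega)) hkD
      simp only [Finset.mem_filter, Finset.mem_product, Finset.mem_Ico, Finset.mem_range]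
      refine ⟨⟨⟨pow_pos hp0 k, h6⟩, hkκ⟩, ?_⟩
      rw [← pow_add]; congr 1; omega
    · intro k _ _ k' _ _ hkk'
      have := (Prod.ext_iff.1 hkk').2
      simpa using this
    · rintro ⟨b, k⟩ hx hne
      simp only [Finset.mem_filter, Finset.mem_product, Finset.mem_Ico, Finset.mem_range] at hx
      obtain ⟨⟨⟨hb, hbD⟩, hk⟩, hbk⟩ := hx
      have hmk : m ≤ k ∧ b = p ^ (k - m) := by
        rcases hκ with ⟨rfl, rfl⟩ | ⟨hp, hκ⟩
        · exact ⟨by omega, by simpa using hbk⟩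
        · have hle : m ≤ k := by
            by_contra hlt
            have h7 : p ^ (κ - m) < p ^ (κ - k) := Nat.pow_lt_pow_right hp.one_lt (by omega)
            have := Nat.le_mul_of_pos_right (p ^ (κ - k)) hb
            omega
          refine ⟨hle, Nat.eq_of_mul_eq_mul_left (pow_pos hp0 (κ - k)) ?_⟩
          rw [hbk, ← pow_add]; congr 1; omega
      obtain ⟨hle, rfl⟩ := hmk
      obtain ⟨k, rfl⟩ := Nat.exists_eq_add_of_le' hle
      simp only [Nat.add_sub_cancel] at hne ⊢
      refine ⟨k, Finset.mem_range.2 (by omega), ?_, rfl⟩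
      intro h0
      apply hne
      have e3 : f * p ^ (k + m) + p ^ k = p ^ k * (f * p ^ m + 1) := by ring
      have e4 : ((f * p ^ (k + m) + p ^ k).choose (f * p ^ (k + m)) : F) =
          ((f * p ^ m + 1 : ℕ) : F) := by
        rw [Nat.choose_symm_add, e3, cast_choose_expChar_pow]
      simp only [AddMonoidHom.comp_apply, AddMonoidHom.coe_mulLeft, one_pow, mul_one]
      rw [e4, e3, mul_comm (p ^ k)]
      exact h0
    · intro k _ _
      have e3 : f * p ^ (k + m) + p ^ k = p ^ k * (f * p ^ m + 1) := by ring
      have e4 : ((f * p ^ (k + m) + p ^ k).choose (f * p ^ (k + m)) : F) =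
          ((f * p ^ m + 1 : ℕ) : F) := by
        rw [Nat.choose_symm_add, e3, cast_choose_expChar_pow]
      simp only [AddMonoidHom.comp_apply, AddMonoidHom.coe_mulLeft, one_pow, mul_one]
      rw [e4, e3, mul_comm (p ^ k)]
  rw [← h3 (y / ((f * p ^ m + 1 : ℕ) : F))]
  refine Finset.sum_congr rfl fun k _ => ?_
  -- Elements of the prime field are fixed by the Frobenius map.
  have e5 : ((f * p ^ m + 1 : ℕ) : F) ^ p ^ k = ((f * p ^ m + 1 : ℕ) : F) := by
    rw [← iterateFrobenius_def, map_natCast]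
  rw [div_pow, e5, mul_div_cancel₀ _ hg]

/-- If `∑ N_j (y^j)` vanishes identically on an infinite field, so does the part with exponents
in `g p^ℕ`, for every `g` prime to the characteristic. -/
theorem sum_frobenius_class_eq_zero [Infinite F] (p : ℕ) [hp : ExpChar F p] {κ : ℕ} (D : ℕ)
    (hκ : IsFrobBound p D κ) (N : ℕ → F →+ A) (hD : ∀ j, D ≤ j → N j = 0)
    (h : ∀ y, ∑ j ∈ Finset.range D, N j (y ^ j) = 0) (g : ℕ) (hg : (g : F) ≠ 0) (y : F) :
    ∑ k ∈ Finset.range κ, N (g * p ^ k) (y ^ p ^ k) = 0 := by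
  induction D using Nat.strong_induction_on generalizing N g y with
  | _ D ih =>
  have hbig : ∀ g : ℕ, (g : F) ≠ 0 → g ≠ 1 → ∀ y,
      ∑ k ∈ Finset.range κ, N (g * p ^ k) (y ^ p ^ k) = 0 := by
    intro g hg hg1 y
    obtain ⟨g, rfl⟩ : ∃ g', g = g' + 1 :=
      ⟨g - 1, by have : g ≠ 0 := fun h0 => hg (by simp [h0])
                 omega⟩
    exact sum_frobenius_class_eq_zero_of_two_le p D hκ
      (fun D' hD' N hN hy g hg y => ih D' hD' (hκ.mono hD'.le) N hN hy g hg y) N hD h g hg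
      (by omega) y
  by_cases hg1 : g = 1
  swap
  · exact hbig g hg hg1 y
  subst hg1
  rcases Nat.lt_or_ge 1 D with h1D | h1D
  swap
  · refine Finset.sum_eq_zero fun k _ => ?_
    have := Nat.one_le_pow k p (expChar_pos F p)
    rw [hD _ (by omega), AddMonoidHom.zero_apply]
  classical
  have hN0 : N 0 (y ^ 0) = 0 := by
    have := h 0
    obtain ⟨D, rfl⟩ : ∃ D', D = D' + 1 := ⟨D - 1, by omega⟩
    rw [Finset.sum_range_succ'] at this
    simpa using this
  have hsum := sum_frobenius_classes (F := F) p hκ (fun j => N j (y ^ j))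
    (fun j hj => by rw [hD j hj]; rfl) hN0 ((Finset.range D).filter fun g => (g : F) ≠ 0)
    (by simp [and_comm])
  rw [h y, Finset.sum_eq_single 1] at hsum
  · simpa using hsum
  · intro g hg hg1
    rw [← hbig g (by simpa using (Finset.mem_filter.1 hg).2) hg1 (y ^ g)]
    simp only [pow_mul]
  · intro h1
    simp [h1D] at h1

/-- A relation `∑ N_{ij} (tⁱ y^j) = 0`, `j ≥ 1`, valid for all `y` and for `t` in a large set
holds for all `t`. -/
theorem sum_bipoly_eq_zero [Infinite F] {D : ℕ} {Λ : Set F}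
    (hΛ : ∀ (p k : ℕ) [ExpChar F p] (c : F), {τ : F | c * τ ^ p ^ k ∈ Λ}.Infinite)
    (N : ℕ → ℕ → F →+ A) (hN0 : ∀ i, N i 0 = 0)
    (h : ∀ t ∈ Λ, ∀ y, ∑ i ∈ Finset.range D, ∑ j ∈ Finset.range D, N i j (t ^ i * y ^ j) = 0)
    (t y : F) : ∑ i ∈ Finset.range D, ∑ j ∈ Finset.range D, N i j (t ^ i * y ^ j) = 0 := by
  classical
  obtain ⟨p, hp⟩ := ExpChar.exists F
  obtain ⟨κ, hκ⟩ := exists_isFrobBound F p D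
  set M : ℕ → ℕ → F →+ A := fun i j => if j < D then N i j else 0 with hM
  have hclass : ∀ g : ℕ, (g : F) ≠ 0 → ∀ t y : F, ∑ i ∈ Finset.range D, ∑ k ∈ Finset.range κ,
      M i (g * p ^ k) (t ^ i * y ^ p ^ k) = 0 := by
    intro g hg
    have h1 : ∀ t ∈ Λ, ∀ y : F, ∑ x ∈ Finset.range D ×ˢ Finset.range κ,
        M x.1 (g * p ^ x.2) (t ^ x.1 * y ^ p ^ x.2) = 0 := by
      intro t ht y
      have := sum_frobenius_class_eq_zero p D hκ
        (fun j => ∑ i ∈ Finset.range D, (M i j).comp (AddMonoidHom.mulLeft (t ^ i)))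
        (fun j hj => Finset.sum_eq_zero fun i _ => by simp [hM, hj.not_gt])
        (fun y => by
          rw [← h t ht y, Finset.sum_comm]
          refine Finset.sum_congr rfl fun j hj => ?_
          simp [hM, Finset.mem_range.1 hj, AddMonoidHom.finsetSum_apply]) g hg y
      rw [Finset.sum_product_right, ← this]
      exact Finset.sum_congr rfl fun k _ => by simp [AddMonoidHom.finsetSum_apply]
    intro t y
    have h2 := sum_ratio_eq_zero p (Finset.range D ×ˢ Finset.range κ) κ
      (by simp only [Finset.mem_product, Finset.mem_range]; intro x hx; omega)
      (hΛ p κ)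
      (fun x => M x.1 (g * p ^ x.2)) h1
    rw [← Finset.sum_product',
      ← Finset.sum_fiberwise_of_maps_to (g := fun x : ℕ × ℕ => p ^ (κ - x.2) * x.1)
        (t := (Finset.range D ×ˢ Finset.range κ).image fun x : ℕ × ℕ => p ^ (κ - x.2) * x.1)
        (fun x hx => Finset.mem_image_of_mem _ hx)]
    exact Finset.sum_eq_zero fun s _ => h2 s t y
  have hsum := fun i => sum_frobenius_classes (F := F) p hκ (fun j => M i j (t ^ i * y ^ j))
    (fun j hj => by simp [hM, hj.not_gt]) (by simp [hM, hN0])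
    ((Finset.range D).filter fun g => (g : F) ≠ 0) (by simp [and_comm])
  have hMN : ∀ i, ∑ j ∈ Finset.range D, N i j (t ^ i * y ^ j) =
      ∑ j ∈ Finset.range D, M i j (t ^ i * y ^ j) := fun i =>
    Finset.sum_congr rfl fun j hj => by simp [hM, Finset.mem_range.1 hj]
  simp only [hMN, ← hsum]
  rw [Finset.sum_comm]
  refine Finset.sum_eq_zero fun g hg => ?_
  simp only [pow_mul]
  exact hclass g (Finset.mem_filter.1 hg).2 t (y ^ g)

end Algebra

/-! ### Functions that are polynomial along planes, and their periods -/

section LinePoly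

variable {F A : Type*} [Field F] [AddCommGroup A]

/-- `B t y` is a finite sum of terms `L (tⁱ y^j)` with `L : F → A` additive. -/
def IsBipoly (B : F → F → A) : Prop :=
  ∃ N : (ℕ × ℕ) →₀ (F →+ A), ∀ t y, B t y = N.sum fun x L => L (t ^ x.1 * y ^ x.2)

theorem IsBipoly.sub {B C : F → F → A} (hB : IsBipoly B) (hC : IsBipoly C) :
    IsBipoly fun t y => B t y - C t y := by
  obtain ⟨N, hN⟩ := hB
  obtain ⟨M, hM⟩ := hC
  refine ⟨N - M, fun t y => ?_⟩
  rw [Finsupp.sum_sub_index (by simp)]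
  simp only [hN, hM]

theorem IsBipoly.sum {ι : Type*} (s : Finset ι) {B : ι → F → F → A} (hB : ∀ i, IsBipoly (B i)) :
    IsBipoly fun t y => ∑ i ∈ s, B i t y := by
  choose N hN using hB
  refine ⟨∑ i ∈ s, N i, fun t y => ?_⟩
  rw [← Finsupp.sum_finsetSum_index (by simp) (by simp)]
  simp only [hN]

theorem IsBipoly.single (L : F →+ A) (i j : ℕ) : IsBipoly fun t y => L (t ^ i * y ^ j) :=
  ⟨Finsupp.single (i, j) L, fun t y => by simp⟩

theorem IsBipoly.of_mvPolynomial (L : F →+ A) (P : MvPolynomial (Fin 2) F) :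
    IsBipoly fun t y => L (MvPolynomial.eval ![t, y] P) := by
  simp only [MvPolynomial.eval_eq', map_sum]
  refine IsBipoly.sum _ fun d => ?_
  simpa using IsBipoly.single (L.comp (AddMonoidHom.mulLeft (P.coeff d))) (d 0) (d 1)

theorem IsBipoly.exists_range {B : F → F → A} (hB : IsBipoly B) :
    ∃ (D : ℕ) (N : ℕ → ℕ → F →+ A), ∀ t y,
      B t y = ∑ i ∈ Finset.range D, ∑ j ∈ Finset.range D, N i j (t ^ i * y ^ j) := by
  obtain ⟨N, hN⟩ := hB
  refine ⟨N.support.sup (fun x => x.1 + x.2) + 1, fun i j => N (i, j), fun t y => ?_⟩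
  rw [hN, ← Finset.sum_product']
  refine Finsupp.sum_of_support_subset _ (fun x hx => ?_) _ (by simp)
  have : x.1 + x.2 ≤ _ := Finset.le_sup (f := fun x : ℕ × ℕ => x.1 + x.2) hx
  simp only [Finset.mem_product, Finset.mem_range]
  omega

/-- `q : Fⁿ → A` is polynomial, with additive maps as coefficients, along every affine plane. -/
def IsPlanePoly {n : ℕ} (q : (Fin n → F) → A) : Prop :=
  ∀ z c w : Fin n → F, IsBipoly fun t y : F => q (z + t • c + y • w)

theorem IsPlanePoly.sub {n : ℕ} {q r : (Fin n → F) → A} (hq : IsPlanePoly q)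
    (hr : IsPlanePoly r) : IsPlanePoly fun u => q u - r u :=
  fun z c w => (hq z c w).sub (hr z c w)

theorem IsPlanePoly.shift {n : ℕ} {q : (Fin n → F) → A} (hq : IsPlanePoly q) (h : Fin n → F) :
    IsPlanePoly fun u => q (u + h) := fun z c w => by
  have := hq (z + h) c w
  exact this.imp fun N hN t y => (congrArg q (by abel)).trans (hN t y)

theorem IsPolynomialMap.isPlanePoly {W : Type*} [AddCommGroup W] [Module F W] {n : ℕ}
    {φ : (Fin n → F) → W} (hφ : IsPolynomialMap φ) (χ : W →+ A) :
    IsPlanePoly fun u => χ (φ u) := by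
  obtain ⟨k, m, w, hm, h⟩ := hφ
  intro z c e
  simp only [h, map_sum]
  refine IsBipoly.sum _ fun j => ?_
  obtain ⟨a, d, -, hmd⟩ := hm j
  have := IsBipoly.of_mvPolynomial
    (χ.comp (LinearMap.toSpanSingleton F W (w j)).toAddMonoidHom)
    (MvPolynomial.C a * ∏ i, (MvPolynomial.C (z i) + MvPolynomial.X 0 * MvPolynomial.C (c i) +
      MvPolynomial.X 1 * MvPolynomial.C (e i)) ^ d i)
  simpa [hmd] using this

/-- The subgroup of those `h` for which the difference of `q` along `h` is constant. -/
def diffPeriods {G : Type*} [AddCommGroup G] (q : G → A) : AddSubgroup G where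
  carrier := {h | ∀ u v, q (u + h) - q u = q (v + h) - q v}
  zero_mem' := by simp
  add_mem' {a b} ha hb u v := by
    have h1 := ha (u + b) (v + b)
    have h2 := hb u v
    rw [show u + (a + b) = u + b + a by abel, show v + (a + b) = v + b + a by abel]
    rw [← sub_add_sub_cancel _ (q (u + b)), h1, h2, sub_add_sub_cancel]
  neg_mem' {a} ha u v := by
    have := ha (u + -a) (v + -a)
    simp only [neg_add_cancel_right] at this
    rw [← neg_sub, this, neg_sub]

theorem infinite_preimage_of_finiteIndex {G : Type*} [AddCommGroup G] [Infinite F]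
    (H : AddSubgroup G) [H.FiniteIndex] (g : F →+ G) : {τ : F | g τ ∈ H}.Infinite := by
  intro hfin
  have h1 : (H.comap g).FiniteIndex := ⟨by
    rw [AddSubgroup.index_comap]
    exact (AddSubgroup.isFiniteRelIndex_of_finiteIndex).relIndex_ne_zero⟩
  have h2 : Finite (H.comap g) := hfin
  have := (AddSubgroup.finite_iff_finite_and_finiteIndex (H := H.comap g)).2 ⟨h2, h1⟩
  exact not_finite F

/-- Over an infinite field, a function that is polynomial along planes and has a constant
difference along a finite-index subgroup is additive up to a constant. The mixed difference
`q (t c + y w) - q (t c) - q (y w) + q 0` is a bipolynomial that vanishes for `t` in a finite-index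
subgroup of `F`, hence for all `t`. -/
theorem IsPlanePoly.additive_of_finiteIndex [Infinite F] {n : ℕ} {q : (Fin n → F) → A}
    (hq : IsPlanePoly q) [(diffPeriods q).FiniteIndex] (c w : Fin n → F) :
    q (c + w) - q c = q w - q 0 := by
  have hB : IsBipoly fun t y : F => (q (0 + t • c + y • w) - q (0 + t • c + y • (0 : Fin n → F))) -
      (q (0 + t • (0 : Fin n → F) + y • w) - q (0 + t • (0 : Fin n → F) + y • (0 : Fin n → F))) :=
    ((hq 0 c w).sub (hq 0 c 0)).sub ((hq 0 0 w).sub (hq 0 0 0))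
  obtain ⟨D, N, hN⟩ := hB.exists_range
  simp only [smul_zero, zero_add, add_zero] at hN
  have hrel : ∀ t y, ∑ i ∈ Finset.range D, ∑ j ∈ Finset.range D,
      (if j = 0 then 0 else N i j) (t ^ i * y ^ j) = q (t • c + y • w) - q (t • c) -
      (q (y • w) - q 0) := by
    intro t y
    have h0 := hN t 0
    simp only [zero_smul, add_zero, sub_self] at h0
    have e : ∑ i ∈ Finset.range D, ∑ j ∈ Finset.range D, N i j (t ^ i * y ^ j) =
        ∑ i ∈ Finset.range D, ∑ j ∈ Finset.range D, N i j (t ^ i * y ^ j) -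
        ∑ i ∈ Finset.range D, ∑ j ∈ Finset.range D, N i j (t ^ i * 0 ^ j) := by
      rw [← h0, sub_zero]
    rw [hN t y, e, ← Finset.sum_sub_distrib]
    refine Finset.sum_congr rfl fun i _ => ?_
    rw [← Finset.sum_sub_distrib]
    refine Finset.sum_congr rfl fun j _ => ?_
    rcases eq_or_ne j 0 with rfl | hj
    · simp
    · simp [hj]
  have := sum_bipoly_eq_zero (F := F) (D := D) (Λ := {t : F | t • c ∈ diffPeriods q})
    (fun p k hp e => infinite_preimage_of_finiteIndex (diffPeriods q)
      ((((LinearMap.toSpanSingleton F (Fin n → F) c).toAddMonoidHom.comp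
        (AddMonoidHom.mulLeft e)).comp (iterateFrobenius F p k).toAddMonoidHom)))
    (fun i j => if j = 0 then 0 else N i j) (by simp)
    (fun t ht y => by
      rw [hrel]
      have := ht (y • w) 0
      rw [zero_add, add_comm] at this
      rw [sub_sub_sub_comm, this]; abel) 1 1
  rw [hrel] at this
  simpa using sub_eq_zero.1 this

end LinePoly

/-! ### Averages along Følner sequences -/

/-- The average of `v` over the `N`-th set of the sequence `Φ`. -/
noncomputable def folnerAvg {G E : Type*} [AddCommGroup E] [Module ℝ E] (Φ : ℕ → Finset G)
    (v : G → E) (N : ℕ) : E :=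
  ((Φ N).card : ℝ)⁻¹ • ∑ u ∈ Φ N, v u

section Averages

variable {G E : Type*} [NormedAddCommGroup E] [NormedSpace ℝ E] {Φ : ℕ → Finset G}

theorem folnerAvg_sum {ι : Type*} (s : Finset ι) (v : ι → G → E) (N : ℕ) :
    folnerAvg Φ (fun u => ∑ i ∈ s, v i u) N = ∑ i ∈ s, folnerAvg Φ (v i) N := by
  simp only [folnerAvg]
  rw [Finset.sum_comm, Finset.smul_sum]

theorem folnerAvg_map {V V' : Type*} [AddCommGroup V] [Module ℝ V] [AddCommGroup V'] [Module ℝ V']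
    (L : V →ₗ[ℝ] V') (v : G → V) (N : ℕ) :
    folnerAvg Φ (fun u => L (v u)) N = L (folnerAvg Φ v N) := by
  simp [folnerAvg]

theorem folnerAvg_const_mul (c : ℂ) (v : G → ℂ) (N : ℕ) :
    folnerAvg Φ (fun u => c * v u) N = c * folnerAvg Φ v N := by
  simp [folnerAvg, ← Finset.mul_sum, mul_left_comm]

theorem norm_folnerAvg_le {v : G → E} {C : ℝ} (hC : 0 ≤ C) (hv : ∀ u, ‖v u‖ ≤ C) (N : ℕ) :
    ‖folnerAvg Φ v N‖ ≤ C := by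
  rw [folnerAvg, norm_smul, norm_inv, Real.norm_natCast]
  rcases Nat.eq_zero_or_pos (Φ N).card with h | h
  · simpa [h] using hC
  · rw [inv_mul_le_iff₀ (by exact_mod_cast h)]
    simpa [nsmul_eq_mul] using norm_sum_le_of_le (Φ N) fun u _ => hv u

theorem folnerAvg_const [AddCommGroup G] (hΦ : IsFolnerSeq Φ) (a : E) (N : ℕ) :
    folnerAvg Φ (fun _ => a) N = a := by
  have : ((Φ N).card : ℝ) ≠ 0 := by
    exact_mod_cast (Finset.card_pos.2 (hΦ.nonempty N)).ne'
  rw [folnerAvg, Finset.sum_const, ← Nat.cast_smul_eq_nsmul ℝ, smul_smul, inv_mul_cancel₀ this,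
    one_smul]

/-- Averages along a Følner sequence are asymptotically invariant under translation. -/
theorem tendsto_folnerAvg_shift_sub [AddCommGroup G] (hΦ : IsFolnerSeq Φ) {v : G → E} {C : ℝ}
    (hv : ∀ u, ‖v u‖ ≤ C) (g : G) :
    Tendsto (fun N => folnerAvg Φ (fun u => v (u + g)) N - folnerAvg Φ v N) atTop (𝓝 0) := by
  classical
  have hC : 0 ≤ C := (norm_nonneg _).trans (hv 0)
  have hlim : Tendsto (fun N => 2 * C * (1 -
      ((((g + ·) '' (Φ N : Set G)) ∩ (Φ N : Set G)).ncard : ℝ) / ((Φ N).card : ℝ)))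
      atTop (𝓝 0) := by
    simpa using ((hΦ.tendsto g).const_sub 1).const_mul (2 * C)
  refine squeeze_zero_norm (fun N => ?_) hlim
  set S := (Φ N).image (g + ·) with hS
  have hcard : S.card = (Φ N).card := Finset.card_image_of_injective _ (add_right_injective g)
  have hpos : (0 : ℝ) < (Φ N).card := by exact_mod_cast Finset.card_pos.2 (hΦ.nonempty N)
  have hset : (((g + ·) '' (Φ N : Set G)) ∩ (Φ N : Set G)).ncard = (S ∩ Φ N).card := by
    rw [← Set.ncard_coe_finset]; simp [hS]
  have h1 : ∑ u ∈ Φ N, v (u + g) = ∑ u ∈ S, v u := by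
    rw [hS, Finset.sum_image (fun a _ b _ h => add_right_injective g h)]
    simp only [add_comm]
  have h2 : ∑ u ∈ S, v u - ∑ u ∈ Φ N, v u = ∑ u ∈ S \ Φ N, v u - ∑ u ∈ Φ N \ S, v u := by
    rw [Finset.sum_sdiff_sub_sum_sdiff]
  have h3 : ((S \ Φ N).card : ℝ) = (Φ N).card - (S ∩ Φ N).card := by
    rw [← hcard, ← Finset.card_sdiff_add_card_inter S (Φ N)]; push_cast; ring
  have h4 : ((Φ N \ S).card : ℝ) = (Φ N).card - (S ∩ Φ N).card := by
    rw [Finset.inter_comm, ← Finset.card_sdiff_add_card_inter (Φ N) S]; push_cast; ring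
  have h5 : ∀ s : Finset G, ‖∑ u ∈ s, v u‖ ≤ s.card * C := fun s => by
    simpa [nsmul_eq_mul] using norm_sum_le_of_le s fun u _ => hv u
  rw [folnerAvg, folnerAvg, ← smul_sub, h1, h2, norm_smul, norm_inv, Real.norm_natCast, hset,
    inv_mul_le_iff₀ hpos]
  calc _ ≤ ‖∑ u ∈ S \ Φ N, v u‖ + ‖∑ u ∈ Φ N \ S, v u‖ := norm_sub_le _ _
    _ ≤ _ := add_le_add (h5 _) (h5 _)
    _ = _ := by rw [h3, h4]; field_simp; ring

/-- If a nonnegative function has zero average along every Følner sequence, it is small outside a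
set of zero upper Banach density. -/
theorem upperBanachDensity_eq_zero_of_tendsto [AddCommGroup G] {v : G → ℝ} (hv : ∀ u, 0 ≤ v u)
    (h : ∀ Φ : ℕ → Finset G, IsFolnerSeq Φ → Tendsto (folnerAvg Φ v) atTop (𝓝 0))
    {δ : ℝ} (hδ : 0 < δ) {S : Set G} (hS : ∀ u ∈ S, δ ≤ v u) : upperBanachDensity S = 0 := by
  classical
  simp only [upperBanachDensity, ENNReal.iSup_eq_zero]
  intro Φ hΦ
  refine Tendsto.limsup_eq (tendsto_of_tendsto_of_tendsto_of_le_of_le tendsto_const_nhds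
    (h := fun N => ENNReal.ofReal (δ⁻¹ * folnerAvg Φ v N)) ?_ (fun N => bot_le) fun N => ?_)
  · have := ENNReal.tendsto_ofReal ((h Φ hΦ).const_mul δ⁻¹)
    simpa using this
  · have hpos : (0 : ℝ) < (Φ N).card := by exact_mod_cast Finset.card_pos.2 (hΦ.nonempty N)
    have hset : (S ∩ (Φ N : Set G)).ncard = ((Φ N).filter (· ∈ S)).card := by
      rw [← Set.ncard_coe_finset]; congr 1; ext; simp [and_comm]
    have h1 : (((Φ N).filter (· ∈ S)).card : ℝ) * δ ≤ ∑ u ∈ Φ N, v u := by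
      rw [← nsmul_eq_mul]
      refine (Finset.card_nsmul_le_sum _ v δ fun u hu => hS u (Finset.mem_filter.1 hu).2).trans ?_
      exact Finset.sum_le_sum_of_subset_of_nonneg (Finset.filter_subset _ _) fun u _ _ => hv u
    simp only [hset]
    rw [← ENNReal.ofReal_natCast, ← ENNReal.ofReal_natCast, ← ENNReal.ofReal_div_of_pos hpos]
    refine ENNReal.ofReal_le_ofReal ?_
    rw [folnerAvg, smul_eq_mul, div_le_iff₀ hpos]
    field_simp
    linarith

/-- Van der Corput: a bounded function with asymptotically uncorrelated translates
has zero average. -/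
theorem tendsto_folnerAvg_of_uncorrelated [AddCommGroup G] (hΦ : IsFolnerSeq Φ) {v : G → ℂ}
    (hv : ∀ u, ‖v u‖ ≤ 1) (h : ℕ → G)
    (hh : ∀ i j, i ≠ j →
      Tendsto (folnerAvg Φ fun u => v (u + h i) * starRingEnd ℂ (v (u + h j))) atTop (𝓝 0)) :
    Tendsto (folnerAvg Φ v) atTop (𝓝 0) := by
  classical
  set c : ℕ → ℕ → ℕ → ℂ := fun i j => folnerAvg Φ fun u => v (u + h i) * starRingEnd ℂ (v (u + h j))
    with hc
  -- Cauchy–Schwarz for the averages of the sums of `k` translates.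
  have hCS : ∀ k N, ‖folnerAvg Φ (fun u => ∑ i ∈ Finset.range k, v (u + h i)) N‖ ^ 2 ≤
      ‖∑ i ∈ Finset.range k, ∑ j ∈ Finset.range k, c i j N‖ := by
    intro k N
    set V : G → ℂ := fun u => ∑ i ∈ Finset.range k, v (u + h i) with hV
    have h1 : ∑ i ∈ Finset.range k, ∑ j ∈ Finset.range k, c i j N =
        ((((Φ N).card : ℝ)⁻¹ * ∑ u ∈ Φ N, ‖V u‖ ^ 2 : ℝ) : ℂ) := by
      simp only [hc]
      simp_rw [← folnerAvg_sum]
      rw [folnerAvg, Complex.real_smul]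
      push_cast
      congr 1
      refine Finset.sum_congr rfl fun u _ => ?_
      rw [← Complex.ofReal_pow, ← Complex.normSq_eq_norm_sq, Complex.normSq_eq_conj_mul_self,
        mul_comm, hV, map_sum, Finset.sum_mul_sum]
    have hpos : (0 : ℝ) < (Φ N).card := by exact_mod_cast Finset.card_pos.2 (hΦ.nonempty N)
    rw [h1, Complex.norm_real, Real.norm_of_nonneg (by positivity), folnerAvg, norm_smul, norm_inv,
      Real.norm_natCast, mul_pow]
    have h2 : ‖∑ u ∈ Φ N, V u‖ ^ 2 ≤ (Φ N).card * ∑ u ∈ Φ N, ‖V u‖ ^ 2 :=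
      (pow_le_pow_left₀ (norm_nonneg _) (norm_sum_le _ _) 2).trans sq_sum_le_card_mul_sum_sq
    calc _ ≤ (((Φ N).card : ℝ)⁻¹) ^ 2 * ((Φ N).card * ∑ u ∈ Φ N, ‖V u‖ ^ 2) := by gcongr
      _ = _ := by field_simp
  have hshift : ∀ k, Tendsto (fun N => folnerAvg Φ (fun u => ∑ i ∈ Finset.range k, v (u + h i)) N -
      k * folnerAvg Φ v N) atTop (𝓝 0) := by
    intro k
    have := tendsto_finsetSum (Finset.range k) fun i _ =>
      tendsto_folnerAvg_shift_sub hΦ hv (h i)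
    simpa [folnerAvg_sum, Finset.sum_sub_distrib] using this
  have hcorr : ∀ k : ℕ, ∀ δ > 0, ∀ᶠ N in atTop,
      ‖∑ i ∈ Finset.range k, ∑ j ∈ Finset.range k, c i j N‖ ≤ k + δ := by
    intro k δ hδ
    have h0 : Tendsto (fun N => ∑ i ∈ Finset.range k, ∑ j ∈ Finset.range k,
        if i = j then 0 else c i j N) atTop (𝓝 0) := by
      have := tendsto_finsetSum (f := fun i N => ∑ j ∈ Finset.range k,
        if i = j then (0 : ℂ) else c i j N) (a := fun _ => 0) (x := atTop) (Finset.range k)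
        fun i _ => by
          have := tendsto_finsetSum (f := fun j N => if i = j then (0 : ℂ) else c i j N)
            (a := fun _ => 0) (x := atTop) (Finset.range k) fun j _ => by
              rcases eq_or_ne i j with hij | hij
              · simp [hij]
              · simpa [hij] using hh i j hij
          simpa using this
      simpa using this
    filter_upwards [(tendsto_zero_iff_norm_tendsto_zero.1 h0).eventually_lt_const hδ] with N hN
    have h1 : ∑ i ∈ Finset.range k, ∑ j ∈ Finset.range k, c i j N =
        ∑ i ∈ Finset.range k, c i i N + ∑ i ∈ Finset.range k, ∑ j ∈ Finset.range k,
        if i = j then 0 else c i j N := by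
      rw [← Finset.sum_add_distrib]
      refine Finset.sum_congr rfl fun i hi => ?_
      have : c i i N = ∑ j ∈ Finset.range k, if i = j then c i j N else 0 := by
        rw [Finset.sum_ite_eq, if_pos hi]
      rw [this, ← Finset.sum_add_distrib]
      exact Finset.sum_congr rfl fun j _ => by split_ifs <;> simp
    rw [h1]
    refine (norm_add_le _ _).trans (add_le_add ?_ hN.le)
    have h2 : ∀ i ∈ Finset.range k, ‖c i i N‖ ≤ 1 := fun i _ =>
      norm_folnerAvg_le zero_le_one (fun u => by
        rw [norm_mul, RCLike.norm_conj]
        exact mul_le_one₀ (hv _) (norm_nonneg _) (hv _)) N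
    simpa using norm_sum_le_of_le _ h2
  rw [Metric.tendsto_atTop']
  intro ε hε
  obtain ⟨k, hk⟩ := exists_nat_gt (8 / ε ^ 2)
  have hk0 : (0 : ℝ) < k := lt_of_le_of_lt (by positivity) hk
  have hk2 : 8 < k * ε ^ 2 := by rwa [div_lt_iff₀ (by positivity)] at hk
  obtain ⟨N₀, hN₀⟩ := eventually_atTop.1 ((hcorr k k hk0).and
    ((tendsto_zero_iff_norm_tendsto_zero.1 (hshift k)).eventually_lt_const
      (show (0 : ℝ) < k * (ε / 2) by positivity)))
  refine ⟨N₀, fun N hN => ?_⟩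
  obtain ⟨h1, h2⟩ := hN₀ N hN.le
  set a := folnerAvg Φ (fun u => ∑ i ∈ Finset.range k, v (u + h i)) N
  have h3 : ‖a‖ ≤ k * (ε / 2) := by
    refine abs_le_of_sq_le_sq' ?_ (by positivity) |>.2
    have := (hCS k N).trans h1
    nlinarith
  have h4 : k * ‖folnerAvg Φ v N‖ ≤ ‖a‖ + ‖a - k * folnerAvg Φ v N‖ := by
    have := norm_sub_le a (a - k * folnerAvg Φ v N)
    rw [sub_sub_cancel, norm_mul, Complex.norm_natCast] at this
    exact this
  rw [dist_zero_right]
  refine lt_of_mul_lt_mul_left (lt_of_le_of_lt h4 ?_) hk0.le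
  linarith

end Averages

/-! ### Equidistribution of polynomial phases over infinite fields -/

/-- The complex number underlying an element of the circle group, written additively. -/
def circleVal (a : Additive Circle) : ℂ := (a.toMul : ℂ)

theorem norm_circleVal (a : Additive Circle) : ‖circleVal a‖ = 1 := Circle.norm_coe _

theorem circleVal_zero : circleVal 0 = 1 := rfl

theorem circleVal_add (a b : Additive Circle) : circleVal (a + b) = circleVal a * circleVal b := rfl

theorem circleVal_sub (a b : Additive Circle) :
    circleVal (a - b) = circleVal a * starRingEnd ℂ (circleVal b) := by
  rw [circleVal, circleVal, circleVal, ← Circle.coe_inv_eq_conj, toMul_sub, div_eq_mul_inv,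
    Circle.coe_mul]

theorem circleVal_injective : Function.Injective circleVal := fun _ _ h =>
  Additive.toMul.injective (Circle.coe_injective h)

section Phases

variable {F : Type*} [Field F] [Infinite F] {n : ℕ}

/-- A nonconstant additive phase has zero average. -/
theorem tendsto_folnerAvg_of_additive {G : Type*} [AddCommGroup G] {Φ : ℕ → Finset G}
    (hΦ : IsFolnerSeq Φ) {q : G → Additive Circle}
    (hq : ∀ c w, q (c + w) - q c = q w - q 0) (hne : ∃ w, q w ≠ q 0) :
    Tendsto (folnerAvg Φ fun u => circleVal (q u)) atTop (𝓝 0) := by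
  obtain ⟨w, hw⟩ := hne
  set z := circleVal (q w - q 0) with hz
  have hz1 : z - 1 ≠ 0 := fun h0 => hw <| sub_eq_zero.1 <| circleVal_injective <| by
    rw [circleVal_zero]; exact sub_eq_zero.1 h0
  have h1 := tendsto_folnerAvg_shift_sub hΦ (v := fun u => circleVal (q u))
    (fun u => (norm_circleVal _).le) w
  have h2 : ∀ u, circleVal (q (u + w)) = z * circleVal (q u) := fun u => by
    rw [hz, ← hq u w, ← circleVal_add, sub_add_cancel]
  simp only [h2, folnerAvg_const_mul, ← sub_one_mul] at h1
  simpa [hz1] using h1.const_mul (z - 1)⁻¹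

theorem exists_seq_sub_notMem {G : Type*} [AddCommGroup G] (H : AddSubgroup G)
    (hH : ¬ H.FiniteIndex) : ∃ h : ℕ → G, ∀ i j, i ≠ j → h i - h j ∉ H := by
  rw [AddSubgroup.finiteIndex_iff_finite_quotient, not_finite_iff_infinite] at hH
  refine ⟨fun i => (Infinite.natEmbedding (G ⧸ H) i).out, fun i j hij hmem => hij ?_⟩
  apply (Infinite.natEmbedding (G ⧸ H)).injective
  rw [← QuotientAddGroup.out_eq' (Infinite.natEmbedding (G ⧸ H) i),
    ← QuotientAddGroup.out_eq' (Infinite.natEmbedding (G ⧸ H) j), eq_comm, QuotientAddGroup.eq]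
  rwa [neg_add_eq_sub]

/-- A polynomial phase on `Fⁿ` is constant or has zero average along every Følner sequence. If the
differences of `q` that are constant have directions in an infinite-index subgroup, there are
infinitely many translates of `q` with nonconstant pairwise differences, of lower degree, and van
der Corput applies; otherwise `q` is additive. -/
theorem constant_or_tendsto_folnerAvg (d : ℕ) {q : (Fin n → F) → Additive Circle}
    (hd : IsDiffPoly d q) (hq : IsPlanePoly q) :
    (∀ u v, q u = q v) ∨ ∀ Φ : ℕ → Finset (Fin n → F), IsFolnerSeq Φ →
      Tendsto (folnerAvg Φ fun u => circleVal (q u)) atTop (𝓝 0) := by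
  induction d generalizing q with
  | zero => exact .inl hd
  | succ d ih =>
    by_cases hH : (diffPeriods q).FiniteIndex
    · by_cases hc : ∀ w, q w = q 0
      · exact .inl fun u v => (hc u).trans (hc v).symm
      · exact .inr fun Φ hΦ => tendsto_folnerAvg_of_additive hΦ hq.additive_of_finiteIndex
          (by simpa using hc)
    · refine .inr fun Φ hΦ => ?_
      obtain ⟨h, hh⟩ := exists_seq_sub_notMem _ hH
      refine tendsto_folnerAvg_of_uncorrelated hΦ (fun u => (norm_circleVal _).le) h
        fun i j hij => ?_
      simp only [← circleVal_sub]
      have hdeg : IsDiffPoly d fun u => q (u + h i) - q (u + h j) := by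
        have := (hd (h i - h j)).shift (h j)
        simpa [fwdDiff, add_assoc] using this
      refine (ih hdeg ((hq.shift (h i)).sub (hq.shift (h j)))).resolve_left (fun hconst => ?_) Φ hΦ
      refine hh i j hij fun u v => ?_
      have := hconst (u - h j) (v - h j)
      simpa [sub_add_eq_add_sub, add_sub_assoc] using this

end Phases

universe u

/-! ### Spectral measures of unitary representations of discrete abelian groups -/

open scoped ComplexOrder in
/-- A positive functional on a commutative C⋆-algebra is integration against a finite measure on
the character space, by Gelfand duality and the Riesz–Markov–Kakutani theorem. -/
theorem exists_measure_characterSpace {𝒜 : Type*} [CommCStarAlgebra 𝒜] (Λ : 𝒜 →ₗ[ℂ] ℂ)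
    (hΛ : ∀ a, 0 ≤ Λ (star a * a)) :
    ∃ (_ : MeasurableSpace (WeakDual.characterSpace ℂ 𝒜))
      (_ : BorelSpace (WeakDual.characterSpace ℂ 𝒜))
      (ν : Measure (WeakDual.characterSpace ℂ 𝒜)), IsFiniteMeasure ν ∧
      ∀ a, ∫ s, s a ∂ν = Λ a := by
  set S := WeakDual.characterSpace ℂ 𝒜
  let _ : MeasurableSpace S := borel S
  have _ : BorelSpace S := ⟨rfl⟩
  let σ : C(S, ℂ) →⋆ₐ[ℂ] 𝒜 := ((gelfandStarTransform 𝒜).symm : C(S, ℂ) →⋆ₐ[ℂ] 𝒜)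
  have hσ : ∀ a, σ (gelfandStarTransform 𝒜 a) = a := (gelfandStarTransform 𝒜).symm_apply_apply
  -- Real continuous functions on the character space, transported to the algebra.
  set e : C(S, ℝ) → C(S, ℂ) := fun g =>
    ⟨fun s => (g s : ℂ), Complex.continuous_ofReal.comp g.continuous⟩ with he
  set ι : C(S, ℝ) → 𝒜 := fun g => σ (e g) with hι
  have hι_add : ∀ g h, ι (g + h) = ι g + ι h := fun g h => by
    have : e (g + h) = e g + e h := by ext s; simp [he]
    rw [hι, ← map_add, ← this]
  have hι_smul : ∀ (r : ℝ) g, ι (r • g) = (r : ℂ) • ι g := fun r g => by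
    have : e (r • g) = (r : ℂ) • e g := by ext s; simp [he]
    rw [hι, ← map_smul, ← this]
  have hι_pos : ∀ g : C(S, ℝ), (∀ s, 0 ≤ g s) → 0 ≤ Λ (ι g) := fun g hg => by
    have : e g = star (e ⟨fun s => √(g s), by fun_prop⟩) * e ⟨fun s => √(g s), by fun_prop⟩ := by
      ext s
      simp [he, ← Complex.ofReal_mul, Real.mul_self_sqrt (hg s)]
    rw [hι]
    beta_reduce
    rw [this, map_mul, map_star]
    exact hΛ _
  have hι_real : ∀ g, (Λ (ι g)).im = 0 := fun g => by
    have h1 : ∀ s, 0 ≤ (g + ‖g‖ • (1 : C(S, ℝ))) s := fun s => by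
      have := neg_le_of_abs_le (g.norm_coe_le_norm s)
      simp; linarith
    have h2 := (Complex.nonneg_iff.1 (hι_pos _ h1)).2
    have h3 := (Complex.nonneg_iff.1 (hι_pos 1 fun s => by simp)).2
    rw [hι_add, hι_smul, map_add, map_smul, Complex.add_im, smul_eq_mul, Complex.im_ofReal_mul,
      ← h3, mul_zero, add_zero] at h2
    exact h2.symm
  set Λr : CompactlySupportedContinuousMap S ℝ →ₗ[ℝ] ℝ :=
    { toFun := fun g => (Λ (ι g.toContinuousMap)).re
      map_add' := fun g h => by
        rw [← Complex.add_re, ← map_add, ← hι_add]; rfl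
      map_smul' := fun r g => by
        rw [RingHom.id_apply, smul_eq_mul, ← Complex.re_ofReal_mul, ← smul_eq_mul, ← map_smul,
          ← hι_smul]; rfl } with hΛr
  set Λp := PositiveLinearMap.mk₀ Λr (fun g hg =>
    (Complex.nonneg_iff.1 (hι_pos g.toContinuousMap hg)).1) with hΛp
  refine ⟨inferInstance, inferInstance, RealRMK.rieszMeasure Λp, inferInstance, fun a => ?_⟩
  have hint : ∀ g : C(S, ℝ), ((∫ s, g s ∂(RealRMK.rieszMeasure Λp) : ℝ) : ℂ) = Λ (ι g) := by
    intro g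
    have := RealRMK.integral_rieszMeasure Λp
      (CompactlySupportedContinuousMap.continuousMapEquiv g)
    have h2 : Λp (CompactlySupportedContinuousMap.continuousMapEquiv g) = (Λ (ι g)).re := rfl
    rw [h2] at this
    refine Complex.ext ?_ ?_
    · rw [Complex.ofReal_re, ← this]; rfl
    · rw [hι_real, Complex.ofReal_im]
  set k := gelfandStarTransform 𝒜 a with hk
  set gr : C(S, ℝ) := ⟨fun s => (k s).re, by fun_prop⟩ with hgr
  set gi : C(S, ℝ) := ⟨fun s => (k s).im, by fun_prop⟩ with hgi
  have ha : a = ι gr + Complex.I • ι gi := by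
    rw [hι]
    beta_reduce
    rw [← map_smul, ← map_add]
    conv_lhs => rw [← hσ a]
    congr 1
    ext s
    simp only [he, hgr, hgi, ContinuousMap.add_apply, ContinuousMap.coe_mk,
      ContinuousMap.smul_apply, smul_eq_mul, mul_comm Complex.I]
    exact (Complex.re_add_im _).symm
  have hki : Integrable (fun s => k s) (RealRMK.rieszMeasure Λp) :=
    k.continuous.integrable_of_hasCompactSupport (HasCompactSupport.of_compactSpace _)
  have h1 : ∫ s, s a ∂(RealRMK.rieszMeasure Λp) = ∫ s, k s ∂(RealRMK.rieszMeasure Λp) := rfl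
  rw [h1, ← integral_re_add_im hki]
  conv_rhs => rw [ha, map_add, map_smul, ← hint, ← hint, smul_eq_mul, mul_comm]
  rfl

/-- `T` is a unitary representation of the additive group `W`. -/
structure IsUnitaryRep {W H : Type*} [AddCommGroup W] [NormedAddCommGroup H]
    [InnerProductSpace ℂ H] (T : W → H →L[ℂ] H) : Prop where
  zero : T 0 = 1
  add : ∀ v w, T (v + w) = T v * T w
  inner_left : ∀ w x y, inner ℂ (T w x) y = inner ℂ x (T (-w) y)

section Spectral

variable {W : Type*} {H : Type u} [AddCommGroup W] [NormedAddCommGroup H] [InnerProductSpace ℂ H]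
  {T : W → H →L[ℂ] H}

theorem IsUnitaryRep.inner_apply (hT : IsUnitaryRep T) (v w : W) (x y : H) :
    inner ℂ (T v x) (T w y) = inner ℂ x (T (w - v) y) := by
  rw [hT.inner_left, ← mul_apply_eq_comp, ← hT.add, neg_add_eq_sub]

theorem IsUnitaryRep.norm_apply (hT : IsUnitaryRep T) (w : W) (x : H) : ‖T w x‖ = ‖x‖ := by
  rw [← sq_eq_sq₀ (norm_nonneg _) (norm_nonneg _), ← Complex.ofReal_inj]
  push_cast
  have := hT.inner_apply w w x x
  rw [sub_self, hT.zero] at this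
  simpa [inner_self_eq_norm_sq_to_K] using this

variable [CompleteSpace H]

/-- The matrix coefficient `w ↦ ⟪f, T w f⟫` is the Fourier transform of a finite measure on a
family of unitary characters of `W`. -/
theorem IsUnitaryRep.exists_spectral_measure (hT : IsUnitaryRep T) (f : H) :
    ∃ (S : Type u) (_ : MeasurableSpace S) (ν : Measure S) (χ : S → W →+ Additive Circle),
      IsFiniteMeasure ν ∧ (∀ w, Measurable fun s => circleVal (χ s w)) ∧
      ∀ w, ∫ s, circleVal (χ s w) ∂ν = inner ℂ f (T w f) := by
  have hstar : ∀ w, star (T w) = T (-w) := fun w => by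
    rw [ContinuousLinearMap.star_eq_adjoint, eq_comm, ContinuousLinearMap.eq_adjoint_iff]
    intro x y
    rw [hT.inner_left, neg_neg]
  have hcomm : ∀ v w, T v * T w = T w * T v := fun v w => by rw [← hT.add, ← hT.add, add_comm]
  set 𝒜₀ := StarAlgebra.adjoin ℂ (Set.range T) with h𝒜₀
  have : IsMulCommutative 𝒜₀ := StarAlgebra.isMulCommutative_adjoin ℂ
    (by rintro _ ⟨v, rfl⟩ _ ⟨w, rfl⟩; exact hcomm v w)
    (by rintro _ ⟨v, rfl⟩ _ ⟨w, rfl⟩; rw [hstar]; exact hcomm v _)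
  set 𝒜 := 𝒜₀.topologicalClosure with h𝒜
  have hclosed : IsClosed (𝒜 : Set (H →L[ℂ] H)) := 𝒜₀.isClosed_topologicalClosure
  let _ : CommCStarAlgebra 𝒜 :=
    { StarSubalgebra.cstarAlgebra 𝒜 with
      mul_comm := (𝒜₀.commRingTopologicalClosure mul_comm').mul_comm }
  have hmem : ∀ w, T w ∈ 𝒜 := fun w =>
    StarSubalgebra.le_topologicalClosure _ (StarAlgebra.subset_adjoin ℂ _ ⟨w, rfl⟩)
  set Λ : 𝒜 →ₗ[ℂ] ℂ :=
    { toFun := fun a => inner ℂ f ((a : H →L[ℂ] H) f)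
      map_add' := fun a b => by simp
      map_smul' := fun c a => by simp } with hΛ
  obtain ⟨m, hm, ν, hν, hint⟩ := exists_measure_characterSpace Λ (fun a => by
    have : Λ (star a * a) = ((‖(a : H →L[ℂ] H) f‖ ^ 2 : ℝ) : ℂ) := by
      change inner ℂ f ((star (a : H →L[ℂ] H) * (a : H →L[ℂ] H)) f) = _
      rw [ContinuousLinearMap.star_eq_adjoint, mul_apply_eq_comp,
        ContinuousLinearMap.adjoint_inner_right, inner_self_eq_norm_sq_to_K]
      simp
    rw [this]
    exact Complex.zero_le_real.2 (sq_nonneg _))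
  set g : W → 𝒜 := fun w => ⟨T w, hmem w⟩ with hg
  have hg0 : g 0 = 1 := Subtype.ext hT.zero
  have hgadd : ∀ v w, g (v + w) = g v * g w := fun v w => Subtype.ext (hT.add v w)
  have hgstar : ∀ w, star (g w) = g (-w) := fun w => Subtype.ext (hstar w)
  have hnorm : ∀ (s : WeakDual.characterSpace ℂ 𝒜) w, ‖s (g w)‖ = 1 := fun s w => by
    have h1 : starRingEnd ℂ (s (g w)) * s (g w) = 1 := by
      rw [starRingEnd_apply, ← map_star, hgstar, ← map_mul, ← hgadd, neg_add_cancel, hg0, map_one]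
    rw [← Complex.normSq_eq_conj_mul_self] at h1
    have h2 : Complex.normSq (s (g w)) = 1 := by exact_mod_cast h1
    rw [Complex.normSq_eq_norm_sq] at h2
    exact (pow_eq_one_iff_of_nonneg (norm_nonneg _) two_ne_zero).1 h2
  refine ⟨WeakDual.characterSpace ℂ 𝒜, m, ν, fun s =>
    { toFun := fun w => Additive.ofMul ⟨s (g w), mem_sphere_zero_iff_norm.2 (hnorm s w)⟩
      map_zero' := ?_
      map_add' := fun v w => ?_ }, hν, fun w => ?_, fun w => hint (g w)⟩
  · apply circleVal_injective
    show s (g 0) = 1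
    rw [hg0, map_one]
  · apply circleVal_injective
    show s (g (v + w)) = s (g v) * s (g w)
    rw [hgadd, map_mul]
  · exact (gelfandStarTransform 𝒜 (g w)).continuous.measurable

end Spectral

/-! ### Mixing along a polynomial on the complement of the eigenvectors -/

section Mixing

variable {W G : Type*} {H : Type u} [AddCommGroup W] [AddCommGroup G] [NormedAddCommGroup H]
  [InnerProductSpace ℂ H] {T : W → H →L[ℂ] H}

/-- The vectors on which every `T (φ u)` acts by a scalar `χ (φ u)`, for a character `χ` of `W`. -/
def eigenvectorsAlong (T : W → H →L[ℂ] H) (φ : G → W) : Set H :=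
  {f | ∃ χ : W →+ Additive Circle, ∀ u, T (φ u) f = circleVal (χ (φ u)) • f}

/-- Finite combinations of translates of `f` have the same norm as the corresponding
trigonometric polynomials in `L²` of the spectral measure of `f`. -/
theorem IsUnitaryRep.norm_sq_linearCombination (hT : IsUnitaryRep T) {f : H} {S : Type*}
    [MeasurableSpace S] {ν : Measure S} [IsFiniteMeasure ν] {χ : S → W →+ Additive Circle}
    (hmeas : ∀ w, Measurable fun s => circleVal (χ s w))
    (hint : ∀ w, ∫ s, circleVal (χ s w) ∂ν = inner ℂ f (T w f)) (c : W →₀ ℂ) :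
    ‖Finsupp.linearCombination ℂ (fun w => T w f) c‖ ^ 2 =
      ∫ s, ‖Finsupp.linearCombination ℂ (fun w => circleVal (χ s w)) c‖ ^ 2 ∂ν := by
  have hintg : ∀ w, Integrable (fun s => circleVal (χ s w)) ν := fun w =>
    Integrable.of_bound (hmeas w).aestronglyMeasurable 1
      (ae_of_all _ fun s => (norm_circleVal _).le)
  rw [← Complex.ofReal_inj, ← integral_complex_ofReal]
  have h1 : ∀ s, ((‖Finsupp.linearCombination ℂ (fun w => circleVal (χ s w)) c‖ ^ 2 : ℝ) : ℂ) =
      ∑ v ∈ c.support, ∑ w ∈ c.support,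
        starRingEnd ℂ (c v) * c w * circleVal (χ s (w - v)) := fun s => by
    rw [← Complex.normSq_eq_norm_sq, Complex.normSq_eq_conj_mul_self,
      Finsupp.linearCombination_apply, Finsupp.sum, map_sum, Finset.sum_mul_sum]
    refine Finset.sum_congr rfl fun v _ => Finset.sum_congr rfl fun w _ => ?_
    rw [map_sub, circleVal_sub, smul_eq_mul, smul_eq_mul, map_mul]
    ring
  simp only [h1]
  rw [integral_finsetSum _ fun v _ => integrable_finsetSum _ fun w _ => (hintg _).const_mul _]
  have hself : ∀ x : H, (‖x‖ : ℂ) ^ 2 = inner ℂ x x := fun x =>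
    (inner_self_eq_norm_sq_to_K (𝕜 := ℂ) x).symm
  rw [Complex.ofReal_pow, hself, Finsupp.linearCombination_apply, Finsupp.sum, sum_inner]
  refine Finset.sum_congr rfl fun v _ => ?_
  rw [inner_sum, integral_finsetSum _ fun w _ => (hintg _).const_mul _]
  refine Finset.sum_congr rfl fun w _ => ?_
  rw [integral_const_mul, hint, inner_smul_left, inner_smul_right, hT.inner_apply, mul_assoc]

variable {F : Type*} [Field F] [Infinite F] {n : ℕ} {φ : (Fin n → F) → W}

/-- The average of `χ₁ / χ₀` along a polynomial detects whether the two characters agree on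
its values. -/
theorem tendsto_folnerAvg_character [Module F W] (hφ : IsPolynomialMap φ)
    {Φ : ℕ → Finset (Fin n → F)} (hΦ : IsFolnerSeq Φ) (χ₀ χ₁ : W →+ Additive Circle)
    [Decidable (∀ u, χ₁ (φ u) = χ₀ (φ u))] :
    Tendsto (folnerAvg Φ fun u =>
      starRingEnd ℂ (circleVal (χ₀ (φ u))) * circleVal (χ₁ (φ u))) atTop
      (𝓝 (if ∀ u, χ₁ (φ u) = χ₀ (φ u) then 1 else 0)) := by
  have h0 : ∀ u, starRingEnd ℂ (circleVal (χ₀ (φ u))) * circleVal (χ₁ (φ u)) =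
      circleVal ((χ₁ - χ₀) (φ u)) := fun u => by
    rw [AddMonoidHom.sub_apply, circleVal_sub, mul_comm]
  simp only [h0]
  obtain ⟨d, hd⟩ := hφ.exists_isDiffPoly
  rcases constant_or_tendsto_folnerAvg d (hd.map (χ₁ - χ₀)) (hφ.isPlanePoly (χ₁ - χ₀)) with h | h
  · have h1 : ∀ u, (χ₁ - χ₀) (φ u) = 0 := fun u => by
      rw [h u 0, hφ.map_zero, map_zero]
    rw [if_pos fun u => sub_eq_zero.1 (h1 u)]
    simp only [h1, circleVal_zero]
    refine tendsto_const_nhds.congr fun N => (folnerAvg_const hΦ (1 : ℂ) N).symm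
  · split_ifs with h1
    · have h2 : ∀ u, (χ₁ - χ₀) (φ u) = 0 := fun u => sub_eq_zero.2 (h1 u)
      simp only [h2, circleVal_zero]
      refine tendsto_const_nhds.congr fun N => (folnerAvg_const hΦ (1 : ℂ) N).symm
    · exact h Φ hΦ

variable [CompleteSpace H]

open scoped Classical in
/-- If `f` is orthogonal to all eigenvectors along `φ`, then the classes of characters that agree
on the values of `φ` are null for the spectral measure of `f`: the averages of
`conj (χ₀ (φ u)) T (φ u) f` converge to an eigenvector `v` with `⟪f, v⟫` the mass of the class of
`χ₀`. -/
theorem IsUnitaryRep.integral_class_eq_zero [Module F W] (hT : IsUnitaryRep T)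
    (hφ : IsPolynomialMap φ) {Φ : ℕ → Finset (Fin n → F)} (hΦ : IsFolnerSeq Φ) {f : H}
    (hf : ∀ v ∈ eigenvectorsAlong T φ, inner ℂ f v = 0) {S : Type*}
    [MeasurableSpace S] {ν : Measure S} [IsFiniteMeasure ν] {χ : S → W →+ Additive Circle}
    (hmeas : ∀ w, Measurable fun s => circleVal (χ s w))
    (hint : ∀ w, ∫ s, circleVal (χ s w) ∂ν = inner ℂ f (T w f)) (χ₀ : W →+ Additive Circle) :
    ∫ s, (if ∀ u, χ s (φ u) = χ₀ (φ u) then 1 else 0 : ℂ) ∂ν = 0 := by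
  set D : S → ℂ := fun s => if ∀ u, χ s (φ u) = χ₀ (φ u) then 1 else 0 with hD
  set p := Finsupp.linearCombination ℂ (fun w => T w f) with hp
  set e : S → (W →₀ ℂ) →ₗ[ℂ] ℂ := fun s =>
    Finsupp.linearCombination ℂ (fun w => circleVal (χ s w)) with he
  have hiso : ∀ c, ‖p c‖ ^ 2 = ∫ s, ‖e s c‖ ^ 2 ∂ν := hT.norm_sq_linearCombination hmeas hint
  have hemeas : ∀ c, Measurable fun s => e s c := fun c => by
    simp only [he, Finsupp.linearCombination_apply, Finsupp.sum]
    exact Finset.measurable_sum _ fun w _ => (hmeas w).const_smul (c w)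
  -- The averages as formal combinations of elements of `W`.
  set a : ℕ → W →₀ ℂ := folnerAvg Φ fun u =>
    Finsupp.single (φ u) (starRingEnd ℂ (circleVal (χ₀ (φ u)))) with ha
  have hea : ∀ s N, e s (a N) = folnerAvg Φ (fun u =>
      starRingEnd ℂ (circleVal (χ₀ (φ u))) * circleVal (χ s (φ u))) N := fun s N => by
    rw [ha, ← LinearMap.restrictScalars_apply ℝ, ← folnerAvg_map]
    simp [he]
  have hbound : ∀ s N, ‖e s (a N)‖ ≤ 1 := fun s N => by
    rw [hea]
    exact norm_folnerAvg_le zero_le_one (fun u => by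
      rw [norm_mul, RCLike.norm_conj, norm_circleVal, norm_circleVal, one_mul]) N
  have hlim : ∀ s, Tendsto (fun N => e s (a N)) atTop (𝓝 (D s)) := fun s => by
    simp only [hea]
    exact tendsto_folnerAvg_character hφ hΦ χ₀ (χ s)
  have hDmeas : Measurable D := measurable_of_tendsto_metrizable (fun N => hemeas (a N))
    (tendsto_pi_nhds.2 hlim)
  have hDbound : ∀ s, ‖D s‖ ≤ 1 := fun s => by simp only [hD]; split_ifs <;> simp
  have hL2 : Tendsto (fun N => ∫ s, ‖e s (a N) - D s‖ ^ 2 ∂ν) atTop (𝓝 0) := by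
    have := tendsto_integral_of_dominated_convergence (μ := ν)
      (F := fun N s => ‖e s (a N) - D s‖ ^ 2) (f := fun _ => 0) (fun _ => 4)
      (fun N => (((hemeas _).sub hDmeas).norm.pow_const 2).aestronglyMeasurable)
      (integrable_const _)
      (fun N => ae_of_all _ fun s => by
        rw [Real.norm_of_nonneg (by positivity)]
        have := (norm_sub_le (e s (a N)) (D s)).trans (add_le_add (hbound s N) (hDbound s))
        nlinarith [norm_nonneg (e s (a N) - D s)])
      (ae_of_all _ fun s => by
        simpa using (((hlim s).sub_const (D s)).norm).pow 2)
    simpa using this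
  have hcauchy : CauchySeq fun N => p (a N) := by
    rw [Metric.cauchySeq_iff']
    intro ε hε
    obtain ⟨N₀, hN₀⟩ := eventually_atTop.1
      (hL2.eventually_lt_const (show (0 : ℝ) < ε ^ 2 / 4 by positivity))
    refine ⟨N₀, fun N hN => ?_⟩
    rw [dist_eq_norm, ← map_sub]
    refine lt_of_pow_lt_pow_left₀ 2 hε.le ?_
    have hi : ∀ N, Integrable (fun s => ‖e s (a N) - D s‖ ^ 2) ν := fun N =>
      Integrable.of_bound (((hemeas _).sub hDmeas).norm.pow_const 2).aestronglyMeasurable 4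
        (ae_of_all _ fun s => by
          rw [Real.norm_of_nonneg (by positivity)]
          have := (norm_sub_le (e s (a N)) (D s)).trans (add_le_add (hbound s N) (hDbound s))
          nlinarith [norm_nonneg (e s (a N) - D s)])
    rw [hiso]
    calc ∫ s, ‖e s (a N - a N₀)‖ ^ 2 ∂ν
        ≤ ∫ s, (2 * ‖e s (a N) - D s‖ ^ 2 + 2 * ‖e s (a N₀) - D s‖ ^ 2) ∂ν := by
          refine integral_mono_of_nonneg (ae_of_all _ fun s => by positivity)
            (((hi N).const_mul 2).add ((hi N₀).const_mul 2)) (ae_of_all _ fun s => ?_)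
          have h1 : ‖e s (a N - a N₀)‖ ≤ ‖e s (a N) - D s‖ + ‖e s (a N₀) - D s‖ := by
            rw [map_sub, ← sub_sub_sub_cancel_right _ _ (D s)]
            exact norm_sub_le _ _
          have h2 := pow_le_pow_left₀ (norm_nonneg _) h1 2
          beta_reduce
          nlinarith [sq_nonneg (‖e s (a N) - D s‖ - ‖e s (a N₀) - D s‖)]
      _ = 2 * ∫ s, ‖e s (a N) - D s‖ ^ 2 ∂ν + 2 * ∫ s, ‖e s (a N₀) - D s‖ ^ 2 ∂ν := by
          rw [integral_add ((hi N).const_mul 2) ((hi N₀).const_mul 2), integral_const_mul,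
            integral_const_mul]
      _ < ε ^ 2 := by linarith [hN₀ N hN, hN₀ N₀ le_rfl]
  obtain ⟨v, hv⟩ := cauchySeq_tendsto_of_complete hcauchy
  have hveig : v ∈ eigenvectorsAlong T φ := by
    refine ⟨χ₀, fun u₀ => ?_⟩
    set z := circleVal (χ₀ (φ u₀)) with hz
    -- `T (φ u₀) - z` acts on combinations as multiplication by `χ (φ u₀) - z`.
    have hnorm : ∀ N, ‖T (φ u₀) (p (a N)) - z • p (a N)‖ ^ 2 =
        ∫ s, ‖(circleVal (χ s (φ u₀)) - z) * e s (a N)‖ ^ 2 ∂ν := fun N => by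
      have h1 : ∀ c : W →₀ ℂ, p (c.mapDomain (φ u₀ + ·)) = T (φ u₀) (p c) := fun c => by
        rw [hp, Finsupp.linearCombination_mapDomain, Finsupp.linearCombination_apply,
          Finsupp.linearCombination_apply, Finsupp.sum, Finsupp.sum, map_sum]
        refine Finset.sum_congr rfl fun w _ => ?_
        rw [map_smul, Function.comp_apply, hT.add, mul_apply_eq_comp]
      have h2 : ∀ s (c : W →₀ ℂ), e s (c.mapDomain (φ u₀ + ·)) =
          circleVal (χ s (φ u₀)) * e s c := fun s c => by
        simp only [he]
        rw [Finsupp.linearCombination_mapDomain, Finsupp.linearCombination_apply,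
          Finsupp.linearCombination_apply, Finsupp.sum, Finsupp.sum, Finset.mul_sum]
        refine Finset.sum_congr rfl fun w _ => ?_
        rw [Function.comp_apply, map_add, circleVal_add, smul_eq_mul, smul_eq_mul]
        ring
      rw [← h1, ← map_smul, ← map_sub, hiso]
      simp only [map_sub, map_smul, h2, sub_mul, smul_eq_mul]
    have hlim1 : Tendsto (fun N => ‖T (φ u₀) (p (a N)) - z • p (a N)‖ ^ 2) atTop (𝓝 0) := by
      simp only [hnorm]
      have := tendsto_integral_of_dominated_convergence (μ := ν)
        (F := fun N s => ‖(circleVal (χ s (φ u₀)) - z) * e s (a N)‖ ^ 2) (f := fun _ => 0)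
        (fun _ => 4)
        (fun N => ((((hmeas _).sub_const z).mul (hemeas _)).norm.pow_const 2).aestronglyMeasurable)
        (integrable_const _)
        (fun N => ae_of_all _ fun s => by
          rw [Real.norm_of_nonneg (by positivity), norm_mul]
          have h1 := norm_sub_le (circleVal (χ s (φ u₀))) z
          rw [norm_circleVal, hz, norm_circleVal] at h1
          have h2 := mul_le_mul h1 (hbound s N) (norm_nonneg _) (by norm_num)
          nlinarith [mul_nonneg (norm_nonneg (circleVal (χ s (φ u₀)) - z))
            (norm_nonneg (e s (a N)))])
        (ae_of_all _ fun s => by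
          have h3 : (circleVal (χ s (φ u₀)) - z) * D s = 0 := by
            simp only [hD]
            split_ifs with h4
            · rw [h4 u₀, hz, sub_self, zero_mul]
            · rw [mul_zero]
          have := (((hlim s).const_mul (circleVal (χ s (φ u₀)) - z)).norm).pow 2
          simpa only [h3, norm_zero, zero_pow two_ne_zero] using this)
      simpa using this
    have hlim2 : Tendsto (fun N => ‖T (φ u₀) (p (a N)) - z • p (a N)‖ ^ 2) atTop
        (𝓝 (‖T (φ u₀) v - z • v‖ ^ 2)) :=
      ((((T (φ u₀)).continuous.tendsto v).comp hv).sub (hv.const_smul z)).norm.pow 2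
    have := tendsto_nhds_unique hlim2 hlim1
    exact sub_eq_zero.1 (norm_eq_zero.1 (pow_eq_zero_iff two_ne_zero |>.1 this))
  have hinner : ∀ N, inner ℂ f (p (a N)) = ∫ s, e s (a N) ∂ν := fun N => by
    simp only [hp, he, Finsupp.linearCombination_apply, Finsupp.sum]
    rw [inner_sum, integral_finsetSum _ fun w _ => ?_]
    · refine Finset.sum_congr rfl fun w _ => ?_
      simp only [smul_eq_mul]
      rw [inner_smul_right, integral_const_mul, hint]
    · exact (Integrable.of_bound (hmeas w).aestronglyMeasurable 1
        (ae_of_all _ fun s => (norm_circleVal _).le)).const_mul _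
  have h1 : Tendsto (fun N => ∫ s, e s (a N) ∂ν) atTop (𝓝 (∫ s, D s ∂ν)) :=
    tendsto_integral_of_dominated_convergence (fun _ => 1)
      (fun N => (hemeas _).aestronglyMeasurable) (integrable_const _)
      (fun N => ae_of_all _ fun s => hbound s N) (ae_of_all _ hlim)
  have h2 : Tendsto (fun N => ∫ s, e s (a N) ∂ν) atTop (𝓝 (inner ℂ f v)) := by
    simp only [← hinner]
    exact ((innerSL ℂ f).continuous.tendsto v).comp hv
  rw [tendsto_nhds_unique h1 h2, hf v hveig]

/-- A vector orthogonal to all eigenvectors along a polynomial `φ` is mixing along `φ` in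
density. -/
theorem IsUnitaryRep.tendsto_folnerAvg_norm_sq_inner [Module F W] (hT : IsUnitaryRep T)
    (hφ : IsPolynomialMap φ) {Φ : ℕ → Finset (Fin n → F)} (hΦ : IsFolnerSeq Φ) {f : H}
    (hf : ∀ v ∈ eigenvectorsAlong T φ, inner ℂ f v = 0) :
    Tendsto (folnerAvg Φ fun u => ‖inner ℂ f (T (φ u) f)‖ ^ 2) atTop (𝓝 0) := by
  classical
  obtain ⟨S, _, ν, χ, _, hmeas, hint⟩ := hT.exists_spectral_measure f
  have hintg : ∀ w, Integrable (fun s => circleVal (χ s w)) ν := fun w =>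
    Integrable.of_bound (hmeas w).aestronglyMeasurable 1
      (ae_of_all _ fun s => (norm_circleVal _).le)
  set b : ℕ → S → S → ℂ := fun N s₀ s => folnerAvg Φ (fun u =>
    starRingEnd ℂ (circleVal (χ s₀ (φ u))) * circleVal (χ s (φ u))) N with hb
  have hbmeas : ∀ N s₀, Measurable (b N s₀) := fun N s₀ => by
    simp only [hb, folnerAvg]
    exact (Finset.measurable_sum _ fun u _ => (hmeas (φ u)).const_mul _).const_smul _
  have hbbound : ∀ N s₀ s, ‖b N s₀ s‖ ≤ 1 := fun N s₀ s =>
    norm_folnerAvg_le zero_le_one (fun u => by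
      rw [norm_mul, RCLike.norm_conj, norm_circleVal, norm_circleVal, one_mul]) N
  have hinner : ∀ s₀, Tendsto (fun N => ∫ s, b N s₀ s ∂ν) atTop (𝓝 0) := fun s₀ => by
    rw [← hT.integral_class_eq_zero hφ hΦ hf hmeas hint (χ s₀)]
    exact tendsto_integral_of_dominated_convergence (fun _ => 1)
      (fun N => (hbmeas N s₀).aestronglyMeasurable) (integrable_const _)
      (fun N => ae_of_all _ fun s => hbbound N s₀ s)
      (ae_of_all _ fun s => tendsto_folnerAvg_character hφ hΦ (χ s₀) (χ s))
  have hbint : ∀ N s₀, ∫ s, b N s₀ s ∂ν = folnerAvg Φ (fun u =>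
      starRingEnd ℂ (circleVal (χ s₀ (φ u))) * inner ℂ f (T (φ u) f)) N := fun N s₀ => by
    simp only [hb, folnerAvg]
    rw [integral_smul, integral_finsetSum _ fun u _ => (hintg _).const_mul _]
    simp only [integral_const_mul, hint]
  have hdouble : ∀ N, ∫ s₀, (∫ s, b N s₀ s ∂ν) ∂ν =
      ((folnerAvg Φ (fun u => ‖inner ℂ f (T (φ u) f)‖ ^ 2) N : ℝ) : ℂ) := fun N => by
    simp only [hbint]
    simp only [folnerAvg]
    have hci : ∀ w, Integrable (fun s => starRingEnd ℂ (circleVal (χ s w))) ν := fun w =>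
      Integrable.of_bound (Complex.continuous_conj.measurable.comp (hmeas w)).aestronglyMeasurable 1
        (ae_of_all _ fun s => by rw [RCLike.norm_conj, norm_circleVal])
    rw [integral_smul, integral_finsetSum _ fun u _ => (hci _).mul_const _, Complex.real_smul,
      smul_eq_mul, Complex.ofReal_mul, Complex.ofReal_sum]
    congr 1
    refine Finset.sum_congr rfl fun u _ => ?_
    rw [integral_mul_const, integral_conj, hint, ← Complex.normSq_eq_conj_mul_self,
      Complex.normSq_eq_norm_sq]
  have hlim : Tendsto (fun N => ∫ s₀, (∫ s, b N s₀ s ∂ν) ∂ν) atTop (𝓝 0) := by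
    have := tendsto_integral_of_dominated_convergence (μ := ν)
      (F := fun N s₀ => ∫ s, b N s₀ s ∂ν) (f := fun _ => 0) (fun _ => ν.real Set.univ)
      (fun N => by
        simp only [hbint, folnerAvg]
        exact ((Finset.measurable_sum _ fun u _ =>
          (Complex.continuous_conj.measurable.comp (hmeas (φ u))).mul_const _).const_smul
          _).aestronglyMeasurable)
      (integrable_const _)
      (fun N => ae_of_all _ fun s₀ => by
        simpa using norm_integral_le_of_norm_le_const (ae_of_all ν fun s => hbbound N s₀ s))
      (ae_of_all _ hinner)
    simpa using this
  simp only [hdouble] at hlim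
  simpa [Function.comp_def] using (Complex.continuous_re.tendsto 0).comp hlim

end Mixing

/-! ### Recurrence for unitary representations -/

theorem IsIPStar.mono {G : Type*} [AddCommGroup G] {r : ℕ} {A B : Set G} (hA : IsIPStar r A)
    (h : A ⊆ B) : IsIPStar r B := fun S hS => (hA S hS).mono (Set.inter_subset_inter_left _ h)

theorem upperBanachDensity_mono {G : Type*} [AddCommGroup G] {S S' : Set G} (h : S ⊆ S') :
    upperBanachDensity S ≤ upperBanachDensity S' := by
  refine iSup₂_mono fun Φ _ => limsup_le_limsup (Eventually.of_forall fun N => ?_)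
  beta_reduce
  gcongr
  exact Set.toFinite _

/-- A set containing an almost IP*_r set is almost IP*_r. -/
theorem IsAlmostIPStar.of_diff_subset {G : Type*} [AddCommGroup G] {r : ℕ} {A E S : Set G}
    (hA : IsIPStar r A) (hE : upperBanachDensity E = 0) (h : A \ E ⊆ S) : IsAlmostIPStar r S := by
  refine ⟨S ∪ A, A \ S, hA.mono Set.subset_union_right, ?_, ?_⟩
  · refine le_antisymm ((upperBanachDensity_mono fun u hu => ?_).trans hE.le) bot_le
    by_contra hne
    exact hu.2 (h ⟨hu.1, hne⟩)
  · ext u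
    simp only [Set.mem_sdiff, Set.mem_union]
    tauto

/-- Distance to `1` is a length function on the circle group. -/
theorem isTotallyBoundedLength_circle :
    IsTotallyBoundedLength fun a : Additive Circle => ‖circleVal a - 1‖ where
  map_zero := by simp [circleVal_zero]
  add_le a b := by
    have : circleVal (a + b) - 1 = circleVal a * (circleVal b - 1) + (circleVal a - 1) := by
      rw [circleVal_add]; ring
    rw [this, add_comm]
    refine (norm_add_le _ _).trans ?_
    rw [norm_mul, norm_circleVal, one_mul, add_comm]
  exists_coloring ε hε := by
    classical
    obtain ⟨t, ht, hcov⟩ := Metric.totallyBounded_iff.1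
      (isCompact_univ (X := Circle)).totallyBounded (ε / 2) (by positivity)
    have hex : ∀ a : Additive Circle, ∃ y : ht.toFinset, dist a.toMul (y : Circle) < ε / 2 := by
      intro a
      obtain ⟨y, hy, hd⟩ := Set.mem_iUnion₂.1 (hcov (Set.mem_univ a.toMul))
      exact ⟨⟨y, by simpa using hy⟩, hd⟩
    choose c hc using hex
    refine ⟨_, fun a => Finset.equivFin _ (c a), fun a b hab => ?_⟩
    have hab' : c a = c b := (Finset.equivFin _).injective hab
    have h1 : dist a.toMul b.toMul < ε := by
      have := dist_triangle_right a.toMul b.toMul (c a : Circle)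
      have h2 := hc b
      rw [← hab'] at h2
      linarith [hc a]
    have h2 : circleVal (a - b) - 1 =
        (circleVal a - circleVal b) * starRingEnd ℂ (circleVal b) := by
      rw [circleVal_sub, sub_mul, Complex.mul_conj, Complex.normSq_eq_norm_sq, norm_circleVal]
      simp
    rw [h2, norm_mul, RCLike.norm_conj, norm_circleVal, mul_one, ← dist_eq_norm]
    exact h1

section Hilbert

variable {W : Type*} {H : Type u} [AddCommGroup W] [NormedAddCommGroup H]
  [InnerProductSpace ℂ H] {T : W → H →L[ℂ] H}

/-- A vector in the closed span of the eigenvectors along `φ` is nearly fixed by `T (φ u)` as soon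
as finitely many characters are nearly `1` at `φ u`. -/
theorem exists_characters_of_mem_closure_span {G : Type*} (hT : IsUnitaryRep T) {φ : G → W}
    {g : H} (hg : g ∈ (Submodule.span ℂ (eigenvectorsAlong T φ)).topologicalClosure) {ε : ℝ}
    (hε : 0 < ε) : ∃ (s : Finset (W →+ Additive Circle)) (δ : ℝ), 0 < δ ∧
      ∀ u, (∀ χ ∈ s, ‖circleVal (χ (φ u)) - 1‖ < δ) → ‖T (φ u) g - g‖ < ε := by
  classical
  have hspan : ∀ g ∈ Submodule.span ℂ (eigenvectorsAlong T φ), ∀ ε > 0,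
      ∃ (s : Finset (W →+ Additive Circle)) (δ : ℝ), 0 < δ ∧
        ∀ u, (∀ χ ∈ s, ‖circleVal (χ (φ u)) - 1‖ < δ) → ‖T (φ u) g - g‖ < ε := by
    intro g hg
    induction hg using Submodule.span_induction with
    | mem x hx =>
      intro ε hε
      obtain ⟨χ, hχ⟩ := hx
      refine ⟨{χ}, ε / (‖x‖ + 1), by positivity, fun u hu => ?_⟩
      have h1 := hu χ (Finset.mem_singleton_self χ)
      have h2 : T (φ u) x - x = (circleVal (χ (φ u)) - 1) • x := by
        rw [hχ u, sub_smul, one_smul]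
      rw [h2, norm_smul]
      rw [lt_div_iff₀ (by positivity)] at h1
      nlinarith [norm_nonneg x, norm_nonneg (circleVal (χ (φ u)) - 1)]
    | zero => exact fun ε hε => ⟨∅, 1, one_pos, fun u _ => by simpa using hε⟩
    | add x y _ _ hx hy =>
      intro ε hε
      obtain ⟨s, δ, hδ, hs⟩ := hx (ε / 2) (by positivity)
      obtain ⟨t, δ', hδ', ht⟩ := hy (ε / 2) (by positivity)
      refine ⟨s ∪ t, min δ δ', lt_min hδ hδ', fun u hu => ?_⟩
      have h1 := hs u fun χ hχ => (hu χ (Finset.mem_union_left t hχ)).trans_le (min_le_left _ _)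
      have h2 := ht u fun χ hχ => (hu χ (Finset.mem_union_right s hχ)).trans_le (min_le_right _ _)
      rw [map_add, add_sub_add_comm]
      exact (norm_add_le _ _).trans_lt (by linarith)
    | smul a x _ hx =>
      intro ε hε
      obtain ⟨s, δ, hδ, hs⟩ := hx (ε / (‖a‖ + 1)) (by positivity)
      refine ⟨s, δ, hδ, fun u hu => ?_⟩
      have h1 := hs u hu
      rw [map_smul, ← smul_sub, norm_smul]
      rw [lt_div_iff₀ (by positivity)] at h1
      nlinarith [norm_nonneg (T (φ u) x - x)]
  obtain ⟨y, hy, hgy⟩ := Metric.mem_closure_iff.1 hg (ε / 3) (by positivity)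
  obtain ⟨s, δ, hδ, hs⟩ := hspan y hy (ε / 3) (by positivity)
  refine ⟨s, δ, hδ, fun u hu => ?_⟩
  have h1 : T (φ u) g - g = T (φ u) (g - y) + (T (φ u) y - y) - (g - y) := by
    rw [map_sub]; abel
  have h2 : ‖T (φ u) (g - y)‖ < ε / 3 := by rw [hT.norm_apply, ← dist_eq_norm]; exact hgy
  rw [dist_eq_norm] at hgy
  rw [h1]
  linarith [norm_sub_le (T (φ u) (g - y) + (T (φ u) y - y)) (g - y),
    norm_add_le (T (φ u) (g - y)) (T (φ u) y - y), hs u hu]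

theorem apply_mem_closure_span {G : Type*} (hT : IsUnitaryRep T) {φ : G → W} (u : G) {w : W}
    (hw : w = φ u ∨ w = -φ u) {g : H}
    (hg : g ∈ (Submodule.span ℂ (eigenvectorsAlong T φ)).topologicalClosure) :
    T w g ∈ (Submodule.span ℂ (eigenvectorsAlong T φ)).topologicalClosure := by
  set K := (Submodule.span ℂ (eigenvectorsAlong T φ)).topologicalClosure with hK
  have hle : K ≤ K.comap (T w : H →ₗ[ℂ] H) := by
    refine Submodule.topologicalClosure_minimal _ (Submodule.span_le.2 fun f hf => ?_)
      ((Submodule.isClosed_topologicalClosure _).preimage (T w).continuous)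
    have hfK : f ∈ K := Submodule.le_topologicalClosure _ (Submodule.subset_span hf)
    obtain ⟨χ, hχ⟩ := hf
    have hz : circleVal (χ (φ u)) ≠ 0 := norm_ne_zero_iff.1 (by simp [norm_circleVal])
    change T w f ∈ K
    rcases hw with rfl | rfl
    · rw [hχ u]
      exact K.smul_mem _ hfK
    · have h1 : T (-φ u) (T (φ u) f) = f := by
        rw [← mul_apply_eq_comp, ← hT.add, neg_add_cancel, hT.zero, one_apply_eq_self]
      rw [hχ u, map_smul] at h1
      have h2 : T (-φ u) f = (circleVal (χ (φ u)))⁻¹ • f := by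
        conv_rhs => rw [← h1]
        rw [inv_smul_smul₀ hz]
      rw [h2]
      exact K.smul_mem _ hfK
  exact hle hg

variable [CompleteSpace H] {F : Type*} [Field F] [Infinite F] [Module F W] {n : ℕ}
  {φ : (Fin n → F) → W}

/-- Large returns along a polynomial: `f = g + h` with `g` in the closed span of the eigenvectors
along `φ` and `h` orthogonal to it. The component `g` returns along an IP*_r set, and `h` is mixing
outside a set of zero upper Banach density. -/
theorem IsUnitaryRep.isAlmostIPStar_returns (hT : IsUnitaryRep T) (hφ : IsPolynomialMap φ)
    (f : H) {o : H} (ho : ∀ w, T w o = o) (ho1 : ‖o‖ ≤ 1) {ε : ℝ} (hε : 0 < ε) :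
    ∃ r : ℕ, 1 ≤ r ∧
      IsAlmostIPStar r {u | (inner ℂ f (T (φ u) f)).re > ‖inner ℂ o f‖ ^ 2 - ε} := by
  classical
  set K := (Submodule.span ℂ (eigenvectorsAlong T φ)).topologicalClosure with hK
  have : CompleteSpace K := (Submodule.isClosed_topologicalClosure _).completeSpace_coe
  set g := K.starProjection f with hg
  have hgK : g ∈ K := K.starProjection_apply_mem f
  set h := f - g with hh
  have hhK : ∀ x ∈ K, inner ℂ x h = 0 :=
    (K.mem_orthogonal h).1 (K.sub_starProjection_mem_orthogonal f)
  have hhK' : ∀ x ∈ K, inner ℂ h x = 0 := fun x hx => by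
    rw [← inner_conj_symm, hhK x hx, map_zero]
  have heig : eigenvectorsAlong T φ ⊆ K := fun x hx =>
    Submodule.le_topologicalClosure _ (Submodule.subset_span hx)
  have hfgh : f = g + h := by rw [hh]; abel
  have hsplit : ∀ u, inner ℂ f (T (φ u) f) = inner ℂ g (T (φ u) g) + inner ℂ h (T (φ u) h) := by
    intro u
    have h1 : inner ℂ g (T (φ u) h) = (0 : ℂ) := by
      have := hT.inner_left (-φ u) g h
      rw [neg_neg] at this
      rw [← this]
      exact hhK _ (apply_mem_closure_span hT u (.inr rfl) hgK)
    have h2 : inner ℂ h (T (φ u) g) = (0 : ℂ) :=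
      hhK' _ (apply_mem_closure_span hT u (.inl rfl) hgK)
    conv_lhs => rw [hfgh, map_add, inner_add_left, inner_add_right, inner_add_right, h1, h2]
    ring
  have hog : ‖inner ℂ o f‖ ≤ ‖g‖ := by
    have hoK : o ∈ K := heig ⟨0, fun u => by simp [ho, circleVal_zero]⟩
    rw [hfgh, inner_add_right, hhK o hoK, add_zero]
    exact (norm_inner_le_norm o g).trans (mul_le_of_le_one_left (norm_nonneg g) ho1)
  obtain ⟨s, δ, hδ, hs⟩ := exists_characters_of_mem_closure_span hT hgK
    (ε := ε / (2 * (‖g‖ + 1))) (by positivity)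
  obtain ⟨d, hd⟩ := hφ.exists_isDiffPoly
  obtain ⟨r, hr, hA⟩ := exists_isIPStar_returns isTotallyBoundedLength_circle (Fin s.card)
    (fun i u => (s.equivFin.symm i : W →+ Additive Circle) (φ u)) (fun i => hd.map _)
    (fun i => by rw [hφ.map_zero, map_zero]) hδ
  refine ⟨r, hr, IsAlmostIPStar.of_diff_subset hA
    (E := {u | ε / 2 ≤ ‖inner ℂ h (T (φ u) h)‖}) ?_ ?_⟩
  · refine upperBanachDensity_eq_zero_of_tendsto
      (v := fun u => ‖inner ℂ h (T (φ u) h)‖ ^ 2) (fun u => by positivity)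
      (fun Φ hΦ => hT.tendsto_folnerAvg_norm_sq_inner hφ hΦ fun v hv => hhK' v (heig hv))
      (δ := (ε / 2) ^ 2) (by positivity) fun u hu => ?_
    exact pow_le_pow_left₀ (by positivity) hu 2
  · rintro u ⟨huA, huE⟩
    have h1 := hs u fun χ hχ => by
      have := huA (s.equivFin ⟨χ, hχ⟩)
      simpa using this
    have h2 : ‖inner ℂ h (T (φ u) h)‖ < ε / 2 := not_le.1 huE
    have h3 : inner ℂ g (T (φ u) g) = (((‖g‖ ^ 2 : ℝ) : ℂ)) + inner ℂ g (T (φ u) g - g) := by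
      rw [inner_sub_right, inner_self_eq_norm_sq_to_K]
      simp
    have h4 : ‖inner ℂ g (T (φ u) g - g)‖ ≤ ε / 2 := by
      refine (norm_inner_le_norm g _).trans ?_
      rw [lt_div_iff₀ (by positivity)] at h1
      nlinarith [norm_nonneg g, norm_nonneg (T (φ u) g - g)]
    have h5 : ‖inner ℂ o f‖ ^ 2 ≤ ‖g‖ ^ 2 := pow_le_pow_left₀ (norm_nonneg _) hog 2
    have h6 := (abs_le.1 ((Complex.abs_re_le_norm _).trans h4)).1
    have h7 := (abs_lt.1 ((Complex.abs_re_le_norm _).trans_lt h2)).1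
    change (inner ℂ f (T (φ u) f)).re > _
    rw [hsplit, h3, Complex.add_re, Complex.add_re, Complex.ofReal_re]
    linarith

end Hilbert

/-! ### Measure-preserving actions -/

section Koopman

variable {W X : Type*} [AddCommGroup W] [MeasurableSpace X] (μ : Measure X) [AddAction W X]
  [MeasurableConstVAdd W X] [VAddInvariantMeasure W X μ]

/-- The Koopman operators `(T w f) x = f (-w + x)` on `L²(μ)`. -/
noncomputable def koopman (w : W) : Lp ℂ 2 μ →L[ℂ] Lp ℂ 2 μ :=
  (Lp.compMeasurePreservingₗᵢ ℂ (fun x : X => -w +ᵥ x)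
    (measurePreserving_vadd (-w) μ)).toContinuousLinearMap

theorem coeFn_koopman (w : W) (f : Lp ℂ 2 μ) :
    koopman μ w f =ᵐ[μ] fun x => f (-w +ᵥ x) :=
  Lp.coeFn_compMeasurePreserving f (measurePreserving_vadd (-w) μ)

theorem isUnitaryRep_koopman : IsUnitaryRep (koopman μ : W → Lp ℂ 2 μ →L[ℂ] Lp ℂ 2 μ) := by
  have hzero : koopman μ (0 : W) = 1 := by
    ext f
    filter_upwards [coeFn_koopman μ (0 : W) f] with x hx
    rw [hx, neg_zero, zero_vadd, one_apply_eq_self]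
  have hadd : ∀ v w : W, koopman μ (v + w) = koopman μ v * koopman μ w := fun v w => by
    ext f
    have h1 := (measurePreserving_vadd (-v) μ).quasiMeasurePreserving.ae (coeFn_koopman μ w f)
    rw [mul_apply_eq_comp]
    filter_upwards [coeFn_koopman μ (v + w) f, coeFn_koopman μ v (koopman μ w f), h1]
      with x hx hx' hx''
    rw [hx, hx', hx'', vadd_vadd, neg_add_rev]
  refine ⟨hzero, hadd, fun w f g => ?_⟩
  have h1 : g = koopman μ w (koopman μ (-w) g) := by
    rw [← mul_apply_eq_comp, ← hadd, add_neg_cancel, hzero, one_apply_eq_self]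
  conv_lhs => rw [h1]
  exact (Lp.compMeasurePreservingₗᵢ ℂ (fun x : X => -w +ᵥ x)
    (measurePreserving_vadd (-w) μ)).inner_map_map f _

theorem koopman_indicatorConstLp [IsFiniteMeasure μ] (w : W) {B : Set X} (hB : MeasurableSet B) :
    koopman μ w (indicatorConstLp 2 hB (measure_ne_top μ B) (1 : ℂ)) =
      indicatorConstLp 2 (hB.const_vadd w) (measure_ne_top μ _) (1 : ℂ) := by
  refine (Lp.indicatorConstLp_compMeasurePreserving hB (measure_ne_top μ B) (1 : ℂ)
    (measurePreserving_vadd (-w) μ)).trans ?_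
  congr 1
  exact Set.preimage_vadd_neg w B

end Koopman

theorem mainTheorem1 {F : Type*} [Field F] [Countable F]
    {W : Type*} [AddCommGroup W] [Module F W] [FiniteDimensional F W]
    {X : Type*} [MeasurableSpace X] (μ : Measure X) [IsProbabilityMeasure μ]
    [AddAction W X] [MeasurableConstVAdd W X] [VAddInvariantMeasure W X μ]
    {n : ℕ} (φ : (Fin n → F) → W) (hφ : IsPolynomialMap φ)
    (B : Set X) (hB : MeasurableSet B) (ε : ℝ) (hε : 0 < ε) :
    ∃ r : ℕ, 1 ≤ r ∧
      IsAlmostIPStar r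
        {u : Fin n → F | μ.real (B ∩ (φ u +ᵥ B)) > μ.real B ^ 2 - ε} := by
  rcases finite_or_infinite F with hfin | hinf
  · -- Over a finite field every long system of finite sums contains `0`.
    classical
    have hν : IsTotallyBoundedLength fun u : Fin n → F => if u = 0 then (0 : ℝ) else 1 :=
      { map_zero := by simp
        add_le := fun a b => by
          by_cases ha : a = 0
          · simp [ha]
          · split_ifs <;> norm_num
        exists_coloring := fun ε hε => by
          obtain ⟨m, ⟨c⟩⟩ := Finite.exists_equiv_fin (Fin n → F)
          exact ⟨m, c, fun a b hab => by simp [c.injective hab, hε]⟩ }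
    obtain ⟨r, hr, hA⟩ := exists_isIPStar_returns hν Unit
      (fun _ u => u) (fun _ => IsDiffPoly.of_addMonoidHom (AddMonoidHom.id (Fin n → F)))
      (fun _ => rfl) one_pos
    refine ⟨r, hr, IsAlmostIPStar.of_diff_subset hA (E := ∅) ?_ fun u hu => ?_⟩
    · simp [upperBanachDensity, upperDensityAlong]
    · have hu0 : u = 0 := by
        by_contra hne
        have := hu.1 ()
        simp [hne] at this
      have hB1 : μ.real B ≤ 1 := measureReal_le_one
      have hB0 : 0 ≤ μ.real B := measureReal_nonneg
      change μ.real (B ∩ (φ u +ᵥ B)) > _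
      rw [hu0, hφ.map_zero, zero_vadd, Set.inter_self]
      nlinarith
  · set f := indicatorConstLp 2 hB (measure_ne_top μ B) (1 : ℂ) with hf
    set o := indicatorConstLp 2 MeasurableSet.univ (measure_ne_top μ Set.univ) (1 : ℂ) with ho
    obtain ⟨r, hr, h⟩ := (isUnitaryRep_koopman (W := W) μ).isAlmostIPStar_returns hφ f (o := o)
      (fun w => by
        rw [ho, koopman_indicatorConstLp]
        congr 1
        exact Set.vadd_set_univ)
      (by rw [ho, norm_indicatorConstLp (by norm_num) (by norm_num)]; simp) hε
    refine ⟨r, hr, ?_⟩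
    convert h using 5 with u
    · rw [hf, koopman_indicatorConstLp, L2.inner_indicatorConstLp_one_indicatorConstLp_one]
      simp
    · rw [hf, ho, L2.inner_indicatorConstLp_one_indicatorConstLp_one]
      simp
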